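/- Let $\mathbb{N}=\{0,1,2,\dots\}$, let $d,m\in\mathbb{N}$, let $U\subseteq\mathbb{R}^d$ be open and let $f:U\to\mathbb{R}$ be an arbitrary function. For an open set $V\subseteq\mathbb{R}^n$, let $\mathcal{Z}^{m,1}(V)$ denote the set of all functions $g:V\to\mathbb{R}$ of class $\mathcal{C}^m$ such that, for every compact set $K\subseteq V$ and every multiindex $\gamma\in\mathbb{N}^n$ with $|\gamma|=m$, \[ \sup\Big\{\frac{|\partial^\gamma g(x+h)-2\,\partial^\gamma g(x)+\partial^\gamma g(x-h)|}{|h|} : x,\ x+h,\ x-h\in K,\ h\neq 0\Big\}<\infty , \] where $\partial^\gamma=\partial_1^{\gamma_1}\cdots\partial_n^{\gamma_n}$ and the supremum of the empty set is $0$. Then the following two conditions are equivalent: 1. $f\circ c\in\mathcal{Z}^{m,1}(\mathbb{R})$ for every $\mathcal{C}^\infty$-curve $c:\mathbb{R}\to\mathbb{R}^d$ with $c(\mathbb{R})\subseteq U$; 2. $f\in\mathcal{Z}^{m,1}(U)$. -/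

import Mathlib

open scoped ContDiff

noncomputable section

/-- The Zygmund class `Z^{0,1}(U)` of continuous functions whose symmetric second difference is
`O(|h|)` uniformly on each compact subset of `U`. Only the values of `f` on `U` matter. -/
def IsZygmundZero {E : Type*} [NormedAddCommGroup E] (U : Set E) (f : E → ℝ) : Prop :=
  ContinuousOn f U ∧
    ∀ K : Set E, K ⊆ U → IsCompact K →
      ∃ C : ℝ, ∀ x h : E, h ≠ 0 → x ∈ K → x + h ∈ K → x - h ∈ K →
        |f (x + h) - 2 * f x + f (x - h)| / ‖h‖ ≤ C

/-- The partial derivative `∂_j f` on `ℝ^d`. -/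
def partialDeriv {d : ℕ} (j : Fin d) (f : EuclideanSpace ℝ (Fin d) → ℝ) :
    EuclideanSpace ℝ (Fin d) → ℝ :=
  fun x => lineDeriv ℝ f x (EuclideanSpace.single j 1)

/-- The iterated partial derivative `∂^γ f = ∂_1^{γ_1} ⋯ ∂_d^{γ_d} f` for a multiindex `γ`.
Its values on an open set depend only on the values of `f` on that set. -/
def multiDeriv {d : ℕ} (γ : Fin d → ℕ) (f : EuclideanSpace ℝ (Fin d) → ℝ) :
    EuclideanSpace ℝ (Fin d) → ℝ :=
  (List.finRange d).foldr (fun j g => (partialDeriv j)^[γ j] g) f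

/-- The local Zygmund class `Z^{m,1}(U)` for an open set `U ⊆ ℝ^d`: functions of class `C^m` on `U`
all of whose partial derivatives of order `m` lie in `Z^{0,1}(U)`. -/
def IsZygmund {d : ℕ} (m : ℕ) (U : Set (EuclideanSpace ℝ (Fin d)))
    (f : EuclideanSpace ℝ (Fin d) → ℝ) : Prop :=
  ContDiffOn ℝ m f U ∧
    ∀ γ : Fin d → ℕ, ∑ i, γ i = m → IsZygmundZero U (multiDeriv γ f)

/-- The local Zygmund class `Z^{m,1}(ℝ)`: the case `d = 1`, `U = ℝ`, written with the ordinary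
derivative of order `m` of a function of one real variable. -/
def IsZygmundReal (m : ℕ) (g : ℝ → ℝ) : Prop :=
  ContDiff ℝ m g ∧ IsZygmundZero Set.univ (iteratedDeriv m g)

end

/-! From 2 to 1, induct on `m`: the chain rule writes `(f ∘ c)'` as a sum of terms `(∂_i f ∘ c) *
c_i'`, and the Zygmund classes on the line are stable under sums and smooth multipliers. For `m =
0`, replace `c (t ± h)` by `c t ± h • c' t`. The error in position is `O(h²)`, and a Zygmund
function is locally Hölder of exponent 1/2, so the error in value is `O(|h|)`.

From 1 to 2, differences of order `m + 2` mediate. Along a curve they are `O(s ^ (m + 1))` by the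
mean value theorem. If they were not locally `O(‖h‖ ^ (m + 1))` for `f` itself, one smooth curve
could run through a rapidly shrinking sequence of bad segments at constant velocity on each, a
contradiction (`exists_ball_fwdDiff_bound`). Continuity of `f` follows by the same device.

The difference bound is turned into regularity by a Littlewood-Paley decomposition. A kernel is
built whose smoothing `T_j` at scale `ε_j ~ 2 ^ (-j)` has as error an average of differences of
order `m + 2`. Telescoping `T_j T_j F` gives a series of smooth terms of size `2 ^ (-j (m + 1))`,
where each derivative costs `2 ^ j` (`exists_dyadic_series`). It can be differentiated termwise `m`
times; what remains has terms `O(2 ^ (-j))` with second derivatives `O(2 ^ j)`, and splitting the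
sum at `2 ^ (-j) ~ ‖h‖` yields the Zygmund estimate. -/

noncomputable section

open Metric Filter Topology MeasureTheory
open scoped Convolution

/-! ### Local Zygmund functions in normed spaces and along curves. -/

section LocallyZygmund

variable {E : Type*} [NormedAddCommGroup E]

/-- A continuous function whose second differences are `O(‖h‖)` near every point of `U`. -/
def LocallyZygmundOn (U : Set E) (f : E → ℝ) : Prop :=
  ContinuousOn f U ∧ ∀ x ∈ U, ∃ r > 0, ∃ C, 0 ≤ C ∧ ∀ y h, y ∈ ball x r → y + h ∈ ball x r →
    y - h ∈ ball x r → |f (y + h) - 2 * f y + f (y - h)| ≤ C * ‖h‖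

/-- Compactness makes the local estimate uniform for `‖h‖ < δ`; for larger `h` the quotient is at
most `4 * M / δ`, where `M` bounds `|f|` on `K`. -/
theorem LocallyZygmundOn.isZygmundZero {U : Set E} {f : E → ℝ} (hf : LocallyZygmundOn U f) :
    IsZygmundZero U f := by
  refine ⟨hf.1, fun K hKU hK => ?_⟩
  obtain ⟨M, hM⟩ : ∃ M, ∀ x ∈ K, |f x| ≤ M := by
    obtain ⟨M, hM⟩ := hK.exists_bound_of_continuousOn (hf.1.mono hKU)
    exact ⟨M, hM⟩
  have key : ∃ δ > 0, ∃ C, ∀ x ∈ K, ∀ h, ‖h‖ < δ →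
      |f (x + h) - 2 * f x + f (x - h)| ≤ C * ‖h‖ := by
    refine hK.induction_on
      (p := fun S => ∃ δ > 0, ∃ C, ∀ x ∈ S, ∀ h, ‖h‖ < δ →
        |f (x + h) - 2 * f x + f (x - h)| ≤ C * ‖h‖) ⟨1, one_pos, 0, by simp⟩ ?_ ?_ ?_
    · rintro s t hst ⟨δ, hδ, C, H⟩
      exact ⟨δ, hδ, C, fun x hx => H x (hst hx)⟩
    · rintro s t ⟨δ, hδ, C, H⟩ ⟨δ', hδ', C', H'⟩
      refine ⟨min δ δ', lt_min hδ hδ', max C C', ?_⟩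
      rintro x (hx | hx) h hh
      · exact (H x hx h (hh.trans_le (min_le_left _ _))).trans (by gcongr; exact le_max_left _ _)
      · exact (H' x hx h (hh.trans_le (min_le_right _ _))).trans (by gcongr; exact le_max_right _ _)
    · intro x hx
      obtain ⟨r, hr, C, -, H⟩ := hf.2 x (hKU hx)
      refine ⟨ball x (r / 2), mem_nhdsWithin_of_mem_nhds (ball_mem_nhds _ (by positivity)),
        r / 2, by positivity, C, fun y hy h hh => ?_⟩
      have hy' : dist y x < r / 2 := hy
      have h1 : dist (y + h) y = ‖h‖ := by simp
      have h2 : dist (y - h) y = ‖h‖ := by simp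
      refine H y h ?_ ?_ ?_ <;> rw [mem_ball]
      · linarith
      · linarith [dist_triangle (y + h) y x]
      · linarith [dist_triangle (y - h) y x]
  obtain ⟨δ, hδ, C, H⟩ := key
  refine ⟨max C (4 * M / δ), fun x h h0 hx hx1 hx2 => ?_⟩
  have hpos : 0 < ‖h‖ := norm_pos_iff.2 h0
  rcases lt_or_ge ‖h‖ δ with hlt | hge
  · exact ((div_le_iff₀ hpos).2 (H x hx h hlt)).trans (le_max_left _ _)
  · refine le_trans ?_ (le_max_right _ _)
    have a1 := abs_le.1 (hM _ hx)
    have a2 := abs_le.1 (hM _ hx1)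
    have a3 := abs_le.1 (hM _ hx2)
    have : |f (x + h) - 2 * f x + f (x - h)| ≤ 4 * M := abs_le.2 ⟨by linarith, by linarith⟩
    have hM0 : 0 ≤ 4 * M := (abs_nonneg _).trans this
    gcongr

theorem IsZygmundZero.locallyZygmundOn [ProperSpace E] {U : Set E} (hU : IsOpen U) {f : E → ℝ}
    (hf : IsZygmundZero U f) : LocallyZygmundOn U f := by
  refine ⟨hf.1, fun x hx => ?_⟩
  obtain ⟨r, hr, hrU⟩ := nhds_basis_closedBall.mem_iff.1 (hU.mem_nhds hx)
  obtain ⟨C, hC⟩ := hf.2 _ hrU (isCompact_closedBall x r)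
  refine ⟨r, hr, max C 0, le_max_right _ _, fun y h h1 h2 h3 => ?_⟩
  rcases eq_or_ne h 0 with rfl | h0
  · simp; ring_nf
  have hpos : 0 < ‖h‖ := norm_pos_iff.2 h0
  have := hC y h h0 (ball_subset_closedBall h1) (ball_subset_closedBall h2)
    (ball_subset_closedBall h3)
  rw [div_le_iff₀ hpos] at this
  exact this.trans (by gcongr; exact le_max_left _ _)

theorem LocallyZygmundOn.exists_small {U : Set E} {f : E → ℝ} (hf : LocallyZygmundOn U f) {x : E}
    (hx : x ∈ U) {ρ : ℝ} (hρ : 0 < ρ) : ∃ r > 0, r ≤ ρ ∧ ∃ C, 0 ≤ C ∧ ∀ y h, y ∈ ball x r →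
    y + h ∈ ball x r → y - h ∈ ball x r → |f (y + h) - 2 * f y + f (y - h)| ≤ C * ‖h‖ := by
  obtain ⟨r, hr, C, hC, H⟩ := hf.2 x hx
  have hs : ball x (min r ρ) ⊆ ball x r := ball_subset_ball (min_le_left _ _)
  exact ⟨min r ρ, lt_min hr hρ, min_le_right _ _, C, hC,
    fun y h h1 h2 h3 => H y h (hs h1) (hs h2) (hs h3)⟩

theorem LocallyZygmundOn.of_forall_ball {U : Set E} {f : E → ℝ}
    (h : ∀ x ∈ U, ∃ r > 0, LocallyZygmundOn (ball x r) f) : LocallyZygmundOn U f := by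
  refine ⟨fun x hx => ?_, fun x hx => ?_⟩ <;> obtain ⟨r, hr, H⟩ := h x hx
  · exact (H.1.continuousAt (ball_mem_nhds x hr)).continuousWithinAt
  · exact H.2 x (mem_ball_self hr)

theorem LocallyZygmundOn.congr {U : Set E} (hU : IsOpen U) {f g : E → ℝ}
    (hf : LocallyZygmundOn U f) (h : Set.EqOn g f U) : LocallyZygmundOn U g := by
  refine ⟨hf.1.congr h, fun x hx => ?_⟩
  obtain ⟨ρ, hρ, hρU⟩ := Metric.isOpen_iff.1 hU x hx
  obtain ⟨r, hr, hrρ, C, hC, H⟩ := hf.exists_small hx hρ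
  have hs := (ball_subset_ball hrρ).trans hρU
  refine ⟨r, hr, C, hC, fun y k h1 h2 h3 => ?_⟩
  rw [h (hs h1), h (hs h2), h (hs h3)]
  exact H y k h1 h2 h3

theorem LocallyZygmundOn.add {U : Set E} {f g : E → ℝ}
    (hf : LocallyZygmundOn U f) (hg : LocallyZygmundOn U g) :
    LocallyZygmundOn U (fun x => f x + g x) := by
  refine ⟨hf.1.add hg.1, fun x hx => ?_⟩
  obtain ⟨r, hr, C, hC, H⟩ := hf.2 x hx
  obtain ⟨r', hr', hrr, C', hC', H'⟩ := hg.exists_small hx hr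
  have hs : ball x r' ⊆ ball x r := ball_subset_ball hrr
  refine ⟨r', hr', C + C', by positivity, fun y k h1 h2 h3 => ?_⟩
  have e1 := H y k (hs h1) (hs h2) (hs h3)
  have e2 := H' y k h1 h2 h3
  rw [show f (y + k) + g (y + k) - 2 * (f y + g y) + (f (y - k) + g (y - k)) =
    (f (y + k) - 2 * f y + f (y - k)) + (g (y + k) - 2 * g y + g (y - k)) by ring, add_mul]
  exact (abs_add_le _ _).trans (add_le_add e1 e2)

theorem ContinuousAt.exists_ball_abs_le {f : E → ℝ} {x : E} (hf : ContinuousAt f x) :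
    ∃ r > 0, ∀ y ∈ ball x r, |f y| ≤ |f x| + 1 := by
  obtain ⟨r, hr, H⟩ := Metric.continuousAt_iff.1 hf 1 one_pos
  refine ⟨r, hr, fun y hy => ?_⟩
  have := H hy
  rw [Real.dist_eq] at this
  linarith [abs_sub_abs_le_abs_sub (f y) (f x)]

variable [NormedSpace ℝ E]

theorem ContDiffAt.exists_ball_abs_sub_le {f : E → ℝ} {x : E} (hf : ContDiffAt ℝ 1 f x) :
    ∃ r > 0, ∃ L, 0 ≤ L ∧ ∀ y ∈ ball x r, ∀ z ∈ ball x r, |f y - f z| ≤ L * ‖y - z‖ := by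
  obtain ⟨K, t, ht, hK⟩ := hf.exists_lipschitzOnWith
  obtain ⟨r, hr, hrt⟩ := Metric.mem_nhds_iff.1 ht
  refine ⟨r, hr, K, K.2, fun y hy z hz => ?_⟩
  simpa [dist_eq_norm] using hK.dist_le_mul y (hrt hy) z (hrt hz)

theorem ContDiffOn.locallyZygmundOn {U : Set E} (hU : IsOpen U) {f : E → ℝ}
    (hf : ContDiffOn ℝ 1 f U) : LocallyZygmundOn U f := by
  refine ⟨hf.continuousOn, fun x hx => ?_⟩
  obtain ⟨r, hr, L, hL, H⟩ := (hf.contDiffAt (hU.mem_nhds hx)).exists_ball_abs_sub_le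
  refine ⟨r, hr, 2 * L, by positivity, fun y h h1 h2 h3 => ?_⟩
  have e1 := H _ h2 _ h1
  have e2 := H _ h3 _ h1
  simp only [add_sub_cancel_left, sub_sub_cancel_left, norm_neg] at e1 e2
  rw [show f (y + h) - 2 * f y + f (y - h) = (f (y + h) - f y) + (f (y - h) - f y) by ring]
  linarith [abs_add_le (f (y + h) - f y) (f (y - h) - f y)]

theorem LocallyZygmundOn.mul_contDiffOn {U : Set E} (hU : IsOpen U) {f g : E → ℝ}
    (hf : LocallyZygmundOn U f) (hg : ContDiffOn ℝ 1 g U) :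
    LocallyZygmundOn U (fun x => f x * g x) := by
  refine ⟨hf.1.mul hg.continuousOn, fun x hx => ?_⟩
  obtain ⟨r₁, hr₁, L, hL, H₁⟩ := (hg.contDiffAt (hU.mem_nhds hx)).exists_ball_abs_sub_le
  obtain ⟨r₂, hr₂, H₂⟩ := (hg.continuousOn.continuousAt (hU.mem_nhds hx)).exists_ball_abs_le
  obtain ⟨r₃, hr₃, H₃⟩ := (hf.1.continuousAt (hU.mem_nhds hx)).exists_ball_abs_le
  obtain ⟨r, hr, hle, C, hC, H⟩ := hf.exists_small hx (lt_min hr₁ (lt_min hr₂ hr₃))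
  have s₁ : ball x r ⊆ ball x r₁ := ball_subset_ball (hle.trans (min_le_left _ _))
  have s₂ : ball x r ⊆ ball x r₂ :=
    ball_subset_ball (hle.trans ((min_le_right _ _).trans (min_le_left _ _)))
  have s₃ : ball x r ⊆ ball x r₃ :=
    ball_subset_ball (hle.trans ((min_le_right _ _).trans (min_le_right _ _)))
  refine ⟨r, hr, C * (|g x| + 1) + 2 * ((|f x| + 1) * L), by positivity,
    fun y h h1 h2 h3 => ?_⟩
  have e1 := H₁ _ (s₁ h2) _ (s₁ h1)
  have e2 := H₁ _ (s₁ h3) _ (s₁ h1)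
  simp only [add_sub_cancel_left, sub_sub_cancel_left, norm_neg] at e1 e2
  have a1 : |(f (y + h) - 2 * f y + f (y - h)) * g y| ≤ C * ‖h‖ * (|g x| + 1) := by
    rw [abs_mul]; exact mul_le_mul (H y h h1 h2 h3) (H₂ y (s₂ h1)) (abs_nonneg _) (by positivity)
  have a2 : |f (y + h) * (g (y + h) - g y)| ≤ (|f x| + 1) * (L * ‖h‖) := by
    rw [abs_mul]; exact mul_le_mul (H₃ _ (s₃ h2)) e1 (abs_nonneg _) (by positivity)
  have a3 : |f (y - h) * (g (y - h) - g y)| ≤ (|f x| + 1) * (L * ‖h‖) := by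
    rw [abs_mul]; exact mul_le_mul (H₃ _ (s₃ h3)) e2 (abs_nonneg _) (by positivity)
  -- With this splitting only first differences of `g` occur, so `g` need only be locally Lipschitz.
  rw [show f (y + h) * g (y + h) - 2 * (f y * g y) + f (y - h) * g (y - h) =
    (f (y + h) - 2 * f y + f (y - h)) * g y + f (y + h) * (g (y + h) - g y)
      + f (y - h) * (g (y - h) - g y) by ring]
  refine (abs_add_three _ _ _).trans ?_
  linarith

/-- A locally Zygmund function is locally Hölder continuous of exponent `1 / 2`. -/
theorem LocallyZygmundOn.exists_ball_abs_sub_le_sqrt {U : Set E} (hU : IsOpen U) {f : E → ℝ}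
    (hf : LocallyZygmundOn U f) {x : E} (hx : x ∈ U) :
    ∃ r > 0, ∃ A, 0 ≤ A ∧ ∀ y ∈ ball x r, ∀ z ∈ ball x r, |f z - f y| ≤ A * √‖z - y‖ := by
  obtain ⟨r₁, hr₁, HM⟩ := (hf.1.continuousAt (hU.mem_nhds hx)).exists_ball_abs_le
  obtain ⟨R, hR, hle, C, hC, H⟩ := hf.exists_small hx (lt_min hr₁ one_pos)
  have sR : ball x R ⊆ ball x r₁ := ball_subset_ball (hle.trans (min_le_left _ _))
  have hR1 : R ≤ 1 := hle.trans (min_le_right _ _)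
  set M := |f x| + 1
  have hM : 0 ≤ M := by positivity
  -- Points `y + h` and `y + 2h` used below stay within `3 * r` of `x`, hence inside the ball of
  -- radius `R`.
  obtain ⟨r, hr⟩ : ∃ r, r = R / 4 := ⟨_, rfl⟩
  have hr0 : 0 < r := by linarith
  set A := max (2 * C) (2 * M / √r)
  have hA : 0 ≤ A := (by positivity : 0 ≤ 2 * C).trans (le_max_left _ _)
  have hAC : 2 * C ≤ A := le_max_left _ _
  have hAM : 2 * M ≤ A * √r := by
    rw [← div_le_iff₀ (by positivity)]; exact le_max_right _ _
  have big : ∀ y h, y ∈ ball x r → ‖h‖ ≤ 2 * r → r ≤ ‖h‖ → |f (y + h) - f y| ≤ A * √‖h‖ := by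
    intro y h hy hh hrh
    have hy' : dist y x < r := hy
    have h1 : dist (y + h) y = ‖h‖ := by simp
    have m1 := abs_le.1 (HM y (sR (by rw [mem_ball]; linarith)))
    have m2 := abs_le.1 (HM (y + h) (sR (by rw [mem_ball]; linarith [dist_triangle (y + h) y x])))
    have : |f (y + h) - f y| ≤ 2 * M := abs_le.2 ⟨by linarith, by linarith⟩
    exact this.trans (hAM.trans (by gcongr))
  -- Induction on the number of doublings that bring `h` to size `r`. Twice `f (y + h) - f y` is `f
  -- (y + 2h) - f y` minus a second difference. Since `√2 ≤ 3 / 2`, the first part uses `3 / 2 * A`,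
  -- and `2 * C ≤ A` with `‖h‖ ≤ 1` lets the second fit in `A / 2`.
  have main : ∀ n : ℕ, ∀ y h, y ∈ ball x r → ‖h‖ ≤ 2 * r → r ≤ 2 ^ n * ‖h‖ →
      |f (y + h) - f y| ≤ A * √‖h‖ := by
    intro n
    induction n with
    | zero => intro y h hy hh hrh; exact big y h hy hh (by simpa using hrh)
    | succ n ih =>
      intro y h hy hh hrh
      rcases le_or_gt r ‖h‖ with hc | hc
      · exact big y h hy hh hc
      have hy' : dist y x < r := hy
      have h1 : dist (y + h) y = ‖h‖ := by simp
      have h2 : dist (y + h + h) (y + h) = ‖h‖ := by simp [dist_eq_norm]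
      have n2 : ‖h + h‖ = 2 * ‖h‖ := by
        rw [← two_smul ℝ h, norm_smul]; norm_num
      have i1 := ih y (h + h) hy (by linarith) (by rw [n2]; rw [pow_succ] at hrh; linarith)
      rw [n2, Real.sqrt_mul (by norm_num), ← add_assoc] at i1
      have i2 := H (y + h) h (by rw [mem_ball]; linarith [dist_triangle (y + h) y x])
        (by rw [mem_ball]; linarith [dist_triangle (y + h) y x, dist_triangle (y + h + h) (y + h) x])
        (by rw [add_sub_cancel_right, mem_ball]; linarith)
      rw [add_sub_cancel_right] at i2
      have s2 : √2 ≤ 3 / 2 := by rw [Real.sqrt_le_left (by norm_num)]; norm_num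
      have hsq : ‖h‖ ≤ √‖h‖ := by
        apply Real.le_sqrt_of_sq_le
        nlinarith [norm_nonneg h]
      have i3 : C * ‖h‖ ≤ A / 2 * √‖h‖ := mul_le_mul (by linarith) hsq (norm_nonneg _) (by positivity)
      have i4 : A * (√2 * √‖h‖) ≤ A * (3 / 2 * √‖h‖) := by gcongr
      have j1 := abs_le.1 i1
      have j2 := abs_le.1 i2
      exact abs_le.2 ⟨by linarith, by linarith⟩
  refine ⟨r, hr0, A, hA, fun y hy z hz => ?_⟩
  rcases eq_or_ne z y with rfl | hzy
  · simp
  have hpos : 0 < ‖z - y‖ := norm_pos_iff.2 (sub_ne_zero.2 hzy)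
  obtain ⟨n, hn⟩ := pow_unbounded_of_one_lt (r / ‖z - y‖) (by norm_num : (1 : ℝ) < 2)
  have hd : ‖z - y‖ ≤ 2 * r := by
    rw [← dist_eq_norm]
    have := dist_triangle_right z y x
    have hy' : dist y x < r := hy
    have hz' : dist z x < r := hz
    linarith
  have := main n y (z - y) hy hd ((div_le_iff₀ hpos).1 hn.le)
  simpa using this

theorem ContDiff.exists_ball_taylor_bound {c : ℝ → E} (hc : ContDiff ℝ 2 c) (t₀ : ℝ) :
    ∃ ρ > 0, ∃ L, 0 ≤ L ∧ (∀ t ∈ ball t₀ ρ, ‖deriv c t‖ ≤ L) ∧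
      ∀ t ∈ ball t₀ ρ, ∀ s ∈ ball t₀ ρ, ‖c s - (c t + (s - t) • deriv c t)‖ ≤ L * (s - t) ^ 2 := by
  have hc1 : ContDiff ℝ 1 (deriv c) := by
    have : ContDiff ℝ (1 + 1) c := by exact_mod_cast hc
    exact (contDiff_succ_iff_deriv.1 this).2.2
  obtain ⟨K, T, hT, hK⟩ := hc1.contDiffAt.exists_lipschitzOnWith (x := t₀)
  obtain ⟨ρ₁, hρ₁, hρT⟩ := Metric.mem_nhds_iff.1 hT
  obtain ⟨ρ₂, hρ₂, hb⟩ := Metric.continuousAt_iff.1 (hc1.continuous.continuousAt (x := t₀)) 1 one_pos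
  have s₁ : ball t₀ (min ρ₁ ρ₂) ⊆ T := (ball_subset_ball (min_le_left _ _)).trans hρT
  refine ⟨min ρ₁ ρ₂, lt_min hρ₁ hρ₂, max K (‖deriv c t₀‖ + 1), K.2.trans (le_max_left _ _), ?_, ?_⟩
  · intro t ht
    have := hb ((mem_ball.1 ht).trans_le (min_le_right _ _))
    rw [dist_eq_norm] at this
    refine le_trans ?_ (le_max_right _ _)
    linarith [norm_sub_norm_le (deriv c t) (deriv c t₀)]
  · intro t ht s hs
    have hsub : Set.uIcc t s ⊆ ball t₀ (min ρ₁ ρ₂) :=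
      (convex_ball _ _).ordConnected.uIcc_subset ht hs
    have hd : ∀ u ∈ Set.uIcc t s, HasDerivWithinAt (fun u => c u - u • deriv c t)
        (deriv c u - deriv c t) (Set.uIcc t s) u := by
      intro u _
      have h1 := (hc.differentiable (by norm_num) u).hasDerivAt
      have h2 := (hasDerivAt_id u).smul_const (deriv c t)
      rw [one_smul] at h2
      exact (h1.sub h2).hasDerivWithinAt
    have hbd : ∀ u ∈ Set.uIcc t s, ‖deriv c u - deriv c t‖ ≤ K * |s - t| := by
      intro u hu
      have := hK.dist_le_mul u (s₁ (hsub hu)) t (s₁ ht)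
      rw [dist_eq_norm, Real.dist_eq] at this
      exact this.trans (mul_le_mul_of_nonneg_left (Set.abs_sub_left_of_mem_uIcc hu) K.2)
    have := (convex_uIcc t s).norm_image_sub_le_of_norm_hasDerivWithin_le hd hbd
      Set.left_mem_uIcc Set.right_mem_uIcc
    rw [show c s - (c t + (s - t) • deriv c t) = c s - s • deriv c t - (c t - t • deriv c t) by
      rw [sub_smul]; abel]
    refine this.trans ?_
    rw [Real.norm_eq_abs, mul_assoc, ← sq, sq_abs]
    gcongr
    exact le_max_left _ _

/-- The second difference of `f` along the tangent line is `O(|h|)`. The curve deviates from that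
line by `O(h²)`, which the Hölder exponent 1/2 turns into `O(|h|)`. -/
theorem LocallyZygmundOn.comp_curve {U : Set E} (hU : IsOpen U) {f : E → ℝ}
    (hf : LocallyZygmundOn U f) {c : ℝ → E} (hc : ContDiff ℝ 2 c) (hcU : ∀ t, c t ∈ U) :
    LocallyZygmundOn Set.univ (f ∘ c) := by
  refine ⟨(hf.1.comp_continuous hc.continuous hcU).continuousOn, fun t₀ _ => ?_⟩
  obtain ⟨r₁, hr₁, A, hA, HA⟩ := hf.exists_ball_abs_sub_le_sqrt hU (hcU t₀)
  obtain ⟨r, hr, hle, C, hC, H⟩ := hf.exists_small (hcU t₀) hr₁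
  obtain ⟨ρ₁, hρ₁, L, hL, HL, HT⟩ := hc.exists_ball_taylor_bound t₀
  obtain ⟨ρ₂, hρ₂, hcont⟩ := Metric.continuousAt_iff.1 (hc.continuous.continuousAt (x := t₀)) (r / 3)
    (by positivity)
  have sr : ball (c t₀) r ⊆ ball (c t₀) r₁ := ball_subset_ball hle
  -- Since `|h| ≤ 2 * ρ₃`, this keeps the tangent displacement `h • deriv c t` below `r / 3`.
  obtain ⟨ρ₃, hρ₃⟩ : ∃ ρ₃, ρ₃ = r / (6 * (L + 1)) := ⟨_, rfl⟩
  have hρ₃0 : 0 < ρ₃ := by rw [hρ₃]; positivity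
  have hρL : 2 * ρ₃ * L ≤ r / 3 := by
    have : ρ₃ * (6 * (L + 1)) = r := by rw [hρ₃]; field_simp
    nlinarith
  set ρ := min ρ₁ (min ρ₂ ρ₃)
  have l1 : ρ ≤ ρ₁ := min_le_left _ _
  have l2 : ρ ≤ ρ₂ := (min_le_right _ _).trans (min_le_left _ _)
  have l3 : ρ ≤ ρ₃ := (min_le_right _ _).trans (min_le_right _ _)
  refine ⟨ρ, lt_min hρ₁ (lt_min hρ₂ hρ₃0), C * L + 2 * (A * √L), by positivity, fun t h h1 h2 h3 => ?_⟩
  have m1 := ball_subset_ball l1 h1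
  have b1 : dist (c t) (c t₀) < r / 3 := hcont (ball_subset_ball l2 h1)
  have b2 : dist (c (t + h)) (c t₀) < r / 3 := hcont (ball_subset_ball l2 h2)
  have b3 : dist (c (t - h)) (c t₀) < r / 3 := hcont (ball_subset_ball l2 h3)
  have hh : |h| ≤ 2 * ρ₃ := by
    have := dist_triangle_right (t + h) t t₀
    rw [Real.dist_eq, add_sub_cancel_left] at this
    have h1' := mem_ball.1 h1
    have h2' := mem_ball.1 h2
    linarith
  have hv : ‖h • deriv c t‖ ≤ L * |h| := by
    rw [norm_smul, mul_comm, Real.norm_eq_abs]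
    gcongr
    exact HL t m1
  have hv' : ‖h • deriv c t‖ ≤ r / 3 := hv.trans (by nlinarith)
  have q1 : c t + h • deriv c t ∈ ball (c t₀) r := by
    have := dist_triangle (c t + h • deriv c t) (c t) (c t₀)
    rw [dist_self_add_left] at this
    rw [mem_ball]; linarith
  have q2 : c t - h • deriv c t ∈ ball (c t₀) r := by
    have := dist_triangle (c t - h • deriv c t) (c t) (c t₀)
    rw [dist_eq_norm (c t - _) (c t), sub_sub_cancel_left, norm_neg] at this
    rw [mem_ball]; linarith
  have e0 := H (c t) (h • deriv c t) (by rw [mem_ball]; linarith) q1 q2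
  have hsq : ∀ w : E, ‖w‖ ≤ L * h ^ 2 → A * √‖w‖ ≤ A * √L * |h| := by
    intro w hw
    rw [mul_assoc, ← Real.sqrt_sq_eq_abs, ← Real.sqrt_mul hL]
    gcongr
  have e1 := (HA _ (sr q1) _ (sr (by rw [mem_ball]; linarith : c (t + h) ∈ ball (c t₀) r))).trans
    (hsq _ (by simpa using HT t m1 (t + h) (ball_subset_ball l1 h2)))
  have e2 := (HA _ (sr q2) _ (sr (by rw [mem_ball]; linarith : c (t - h) ∈ ball (c t₀) r))).trans
    (hsq _ (by simpa [sub_eq_add_neg] using HT t m1 (t - h) (ball_subset_ball l1 h3)))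
  have e0' : |f (c t + h • deriv c t) - 2 * f (c t) + f (c t - h • deriv c t)| ≤ C * (L * |h|) :=
    e0.trans (by gcongr)
  simp only [Function.comp_apply, Real.norm_eq_abs]
  have j0 := abs_le.1 e0'
  have j1 := abs_le.1 e1
  have j2 := abs_le.1 e2
  exact abs_le.2 ⟨by linarith, by linarith⟩

end LocallyZygmund

/-! ### The classes `Z^{m,1}(ℝ)`: recursion in `m`, sums and smooth multipliers. -/

section Real

theorem isZygmundReal_zero_iff {g : ℝ → ℝ} :
    IsZygmundReal 0 g ↔ LocallyZygmundOn Set.univ g := by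
  unfold IsZygmundReal
  rw [iteratedDeriv_zero]
  refine ⟨fun h => h.2.locallyZygmundOn isOpen_univ, fun h => ⟨?_, h.isZygmundZero⟩⟩
  exact_mod_cast contDiff_zero.2 (continuousOn_univ.1 h.1)

theorem isZygmundReal_succ_iff {m : ℕ} {g : ℝ → ℝ} :
    IsZygmundReal (m + 1) g ↔ Differentiable ℝ g ∧ IsZygmundReal m (deriv g) := by
  unfold IsZygmundReal
  rw [iteratedDeriv_succ']
  push_cast
  rw [contDiff_succ_iff_deriv]
  simp [and_assoc]

theorem ContDiff.isZygmundReal {m : ℕ} {g : ℝ → ℝ} (hg : ContDiff ℝ (m + 1) g) :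
    IsZygmundReal m g := by
  induction m generalizing g with
  | zero =>
    exact isZygmundReal_zero_iff.2
      (ContDiffOn.locallyZygmundOn isOpen_univ (by simpa using hg.contDiffOn))
  | succ m ih =>
    have := contDiff_succ_iff_deriv.1 hg
    exact isZygmundReal_succ_iff.2 ⟨this.1, ih (by exact_mod_cast this.2.2)⟩

theorem IsZygmundReal.of_succ {m : ℕ} {g : ℝ → ℝ} (hg : IsZygmundReal (m + 1) g) :
    IsZygmundReal m g := ContDiff.isZygmundReal (by exact_mod_cast hg.1)

theorem IsZygmundReal.add {m : ℕ} {f g : ℝ → ℝ} (hf : IsZygmundReal m f)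
    (hg : IsZygmundReal m g) : IsZygmundReal m (fun t => f t + g t) := by
  induction m generalizing f g with
  | zero =>
    rw [isZygmundReal_zero_iff] at *
    exact hf.add hg
  | succ m ih =>
    rw [isZygmundReal_succ_iff] at *
    refine ⟨hf.1.add hg.1, ?_⟩
    have : deriv (fun t => f t + g t) = fun t => deriv f t + deriv g t :=
      funext fun t => deriv_fun_add (hf.1 t) (hg.1 t)
    rw [this]
    exact ih hf.2 hg.2

theorem IsZygmundReal.mul_contDiff {m : ℕ} {f g : ℝ → ℝ} (hf : IsZygmundReal m f)
    (hg : ContDiff ℝ ∞ g) : IsZygmundReal m (fun t => f t * g t) := by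
  induction m generalizing f g with
  | zero =>
    rw [isZygmundReal_zero_iff] at *
    exact hf.mul_contDiffOn isOpen_univ (hg.of_le (by exact_mod_cast le_top)).contDiffOn
  | succ m ih =>
    have hf' := hf.of_succ
    rw [isZygmundReal_succ_iff] at *
    have hg1 := contDiff_infty_iff_deriv.1 hg
    refine ⟨hf.1.mul hg1.1, ?_⟩
    have : deriv (fun t => f t * g t) = fun t => deriv f t * g t + f t * deriv g t :=
      funext fun t => deriv_fun_mul (hf.1 t) (hg1.1 t)
    rw [this]
    exact (ih hf.2 hg).add (ih hf' hg1.2)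

theorem IsZygmundReal.sum {m : ℕ} {ι : Type*} (s : Finset ι) {f : ι → ℝ → ℝ}
    (hf : ∀ i ∈ s, IsZygmundReal m (f i)) : IsZygmundReal m (fun t => ∑ i ∈ s, f i t) := by
  classical
  induction s using Finset.induction_on with
  | empty => simpa using ContDiff.isZygmundReal contDiff_const
  | insert a s ha ih =>
    simp_rw [Finset.sum_insert ha]
    exact (hf a (by simp)).add (ih fun i hi => hf i (by simp [hi]))

end Real

/-! ### Iterated partial derivatives along lists, and the chain rule along curves. -/

section Partial

variable {d : ℕ} {U : Set (EuclideanSpace ℝ (Fin d))}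

/-- The iterated partial derivative `∂_{i_1} ⋯ ∂_{i_k} f` along a list of indices. -/
def listDeriv (l : List (Fin d)) (f : EuclideanSpace ℝ (Fin d) → ℝ) :
    EuclideanSpace ℝ (Fin d) → ℝ :=
  l.foldr partialDeriv f

theorem listDeriv_append (l l' : List (Fin d)) (f : EuclideanSpace ℝ (Fin d) → ℝ) :
    listDeriv (l ++ l') f = listDeriv l (listDeriv l' f) := List.foldr_append

theorem partialDeriv_eq_fderiv {f : EuclideanSpace ℝ (Fin d) → ℝ} {x : EuclideanSpace ℝ (Fin d)}
    (hf : DifferentiableAt ℝ f x) (j : Fin d) :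
    partialDeriv j f x = fderiv ℝ f x (EuclideanSpace.single j 1) := hf.lineDeriv_eq_fderiv

theorem partialDeriv_congr (hU : IsOpen U) {f g : EuclideanSpace ℝ (Fin d) → ℝ}
    (h : Set.EqOn f g U) (j : Fin d) : Set.EqOn (partialDeriv j f) (partialDeriv j g) U :=
  fun _ hx => (h.eventuallyEq_of_mem (hU.mem_nhds hx)).lineDeriv_eq

theorem listDeriv_congr (hU : IsOpen U) {f g : EuclideanSpace ℝ (Fin d) → ℝ}
    (h : Set.EqOn f g U) (l : List (Fin d)) : Set.EqOn (listDeriv l f) (listDeriv l g) U := by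
  induction l with
  | nil => exact h
  | cons j l ih => exact partialDeriv_congr hU ih j

theorem EuclideanSpace.clm_eq_sum_single (L : EuclideanSpace ℝ (Fin d) →L[ℝ] ℝ) :
    L = ∑ i, L (EuclideanSpace.single i 1) •
      (EuclideanSpace.proj i : EuclideanSpace ℝ (Fin d) →L[ℝ] ℝ) := by
  ext v
  have hv : v = ∑ i, v i • EuclideanSpace.single i (1 : ℝ) := by
    ext j
    simp [Pi.single_apply]
  conv_lhs => rw [hv]
  simp [map_sum, mul_comm]

theorem contDiffOn_partialDeriv (hU : IsOpen U) {f : EuclideanSpace ℝ (Fin d) → ℝ} {n : ℕ}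
    (hf : ContDiffOn ℝ (n + 1) f U) (j : Fin d) : ContDiffOn ℝ n (partialDeriv j f) U := by
  have h := (contDiffOn_succ_iff_fderiv_of_isOpen hU).1 hf
  refine (h.2.2.clm_apply contDiffOn_const).congr fun x hx =>
    partialDeriv_eq_fderiv (h.1.differentiableAt (hU.mem_nhds hx)) j

theorem contDiffOn_succ_of_partialDeriv (hU : IsOpen U) {f : EuclideanSpace ℝ (Fin d) → ℝ} {n : ℕ}
    (hf : DifferentiableOn ℝ f U) (h : ∀ j, ContDiffOn ℝ n (partialDeriv j f) U) :
    ContDiffOn ℝ (n + 1) f U := by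
  refine (contDiffOn_succ_iff_fderiv_of_isOpen hU).2 ⟨hf, by simp, ?_⟩
  have : ContDiffOn ℝ n (fun x => ∑ i, partialDeriv i f x •
      (EuclideanSpace.proj i : EuclideanSpace ℝ (Fin d) →L[ℝ] ℝ)) U :=
    ContDiffOn.sum fun i _ => (h i).smul contDiffOn_const
  refine this.congr fun x hx => ?_
  rw [EuclideanSpace.clm_eq_sum_single (fderiv ℝ f x)]
  refine Finset.sum_congr rfl fun i _ => ?_
  rw [partialDeriv_eq_fderiv (hf.differentiableAt (hU.mem_nhds hx)) i]

theorem contDiffOn_listDeriv (hU : IsOpen U) {f : EuclideanSpace ℝ (Fin d) → ℝ} {n : ℕ}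
    (l : List (Fin d)) (hf : ContDiffOn ℝ (n + l.length : ℕ) f U) :
    ContDiffOn ℝ n (listDeriv l f) U := by
  induction l generalizing n with
  | nil => exact hf
  | cons j l ih =>
    refine contDiffOn_partialDeriv hU (ih (n := n + 1) ?_) j
    rwa [add_assoc, add_comm 1]

theorem partialDeriv_comm (hU : IsOpen U) {f : EuclideanSpace ℝ (Fin d) → ℝ}
    (hf : ContDiffOn ℝ 2 f U) (i j : Fin d) :
    Set.EqOn (partialDeriv i (partialDeriv j f)) (partialDeriv j (partialDeriv i f)) U := by
  intro x hx
  have h1 := (contDiffOn_succ_iff_fderiv_of_isOpen (n := 1) hU).1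
    (by simpa [one_add_one_eq_two] using hf)
  have key : ∀ i j : Fin d, partialDeriv i (partialDeriv j f) x =
      fderiv ℝ (fderiv ℝ f) x (EuclideanSpace.single i 1) (EuclideanSpace.single j 1) := by
    intro i j
    have e : Set.EqOn (partialDeriv j f) (fun y => fderiv ℝ f y (EuclideanSpace.single j 1)) U :=
      fun y hy => partialDeriv_eq_fderiv (h1.1.differentiableAt (hU.mem_nhds hy)) j
    have hd : DifferentiableAt ℝ (fderiv ℝ f) x :=
      ((h1.2.2.differentiableOn (by norm_num)) x hx).differentiableAt (hU.mem_nhds hx)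
    rw [partialDeriv_congr hU e i hx, partialDeriv_eq_fderiv (by fun_prop) i,
      fderiv_clm_apply hd (by fun_prop)]
    simp
  rw [key, key]
  exact ((hf.contDiffAt (hU.mem_nhds hx)).isSymmSndFDerivAt (by simp)).eq _ _

/-- Each adjacent transposition acts on a `C^2` function, where second derivatives are symmetric.
This frees the induction on `m` from the fixed order of derivatives in `multiDeriv`. -/
theorem listDeriv_perm (hU : IsOpen U) {f : EuclideanSpace ℝ (Fin d) → ℝ}
    {l l' : List (Fin d)} (h : l.Perm l') (hf : ContDiffOn ℝ (l.length) f U) :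
    Set.EqOn (listDeriv l f) (listDeriv l' f) U := by
  induction h with
  | nil => exact fun _ _ => rfl
  | cons j _ ih =>
    exact partialDeriv_congr hU (ih (hf.of_le (by simp))) j
  | swap i j l =>
    refine partialDeriv_comm hU (contDiffOn_listDeriv (n := 2) hU l ?_) j i
    exact hf.of_le (by simp only [List.length_cons]; norm_cast; omega)
  | trans h1 _ ih1 ih2 =>
    exact (ih1 hf).trans (ih2 (by rwa [← h1.length_eq]))

/-- The list of indices in which each `j` occurs `γ j` times, in increasing order. -/
def multiIndexList (γ : Fin d → ℕ) : List (Fin d) :=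
  (List.finRange d).flatMap fun j => List.replicate (γ j) j

theorem multiDeriv_eq_listDeriv (γ : Fin d → ℕ) (f : EuclideanSpace ℝ (Fin d) → ℝ) :
    multiDeriv γ f = listDeriv (multiIndexList γ) f := by
  unfold multiDeriv multiIndexList
  induction List.finRange d with
  | nil => rfl
  | cons j l ih =>
    rw [List.foldr_cons, ih, List.flatMap_cons, listDeriv_append]
    induction γ j with
    | zero => rfl
    | succ n ih => rw [Function.iterate_succ_apply', ih]; rfl

theorem length_multiIndexList (γ : Fin d → ℕ) : (multiIndexList γ).length = ∑ i, γ i := by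
  simp [multiIndexList, List.length_flatMap, ← List.sum_ofFn, List.ofFn_eq_map]

theorem count_multiIndexList (γ : Fin d → ℕ) (i : Fin d) : (multiIndexList γ).count i = γ i := by
  rw [multiIndexList, List.count_flatMap, ← List.ofFn_eq_map, List.sum_ofFn]
  simp [List.count_replicate]

/-- Functions of class `C^m` on `U` all of whose iterated partial derivatives of order `m`, taken
in any order, are locally Zygmund. -/
def PartialZygmundOn (m : ℕ) (U : Set (EuclideanSpace ℝ (Fin d)))
    (f : EuclideanSpace ℝ (Fin d) → ℝ) : Prop :=
  ContDiffOn ℝ m f U ∧ ∀ l : List (Fin d), l.length = m → LocallyZygmundOn U (listDeriv l f)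

theorem isZygmund_iff (hU : IsOpen U) {m : ℕ} {f : EuclideanSpace ℝ (Fin d) → ℝ} :
    IsZygmund m U f ↔ PartialZygmundOn m U f := by
  constructor
  · rintro ⟨hf, H⟩
    refine ⟨hf, fun l hl => ?_⟩
    have hp : l.Perm (multiIndexList fun i => l.count i) :=
      List.perm_iff_count.2 fun i => (count_multiIndexList (fun i => l.count i) i).symm
    have hs : ∑ i, l.count i = m := by rw [← hl, hp.length_eq, length_multiIndexList]
    have := (H _ hs).locallyZygmundOn hU
    rw [multiDeriv_eq_listDeriv] at this
    exact this.congr hU (listDeriv_perm hU hp (by rwa [hl]))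
  · rintro ⟨hf, H⟩
    refine ⟨hf, fun γ hγ => ?_⟩
    rw [multiDeriv_eq_listDeriv]
    exact (H _ (by rw [length_multiIndexList, hγ])).isZygmundZero

theorem partialZygmundOn_zero_iff {f : EuclideanSpace ℝ (Fin d) → ℝ} :
    PartialZygmundOn 0 U f ↔ LocallyZygmundOn U f := by
  constructor
  · exact fun h => h.2 [] rfl
  · refine fun h => ⟨by exact_mod_cast contDiffOn_zero (𝕜 := ℝ) |>.2 h.1, fun l hl => ?_⟩
    rw [List.length_eq_zero_iff.1 hl]
    exact h

/-- The derivative split off is the one applied first to `f`, that is, the last entry of the list.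
-/
theorem partialZygmundOn_succ_iff (hU : IsOpen U) {m : ℕ} {f : EuclideanSpace ℝ (Fin d) → ℝ} :
    PartialZygmundOn (m + 1) U f ↔
      ContDiffOn ℝ (m + 1) f U ∧ ∀ i, PartialZygmundOn m U (partialDeriv i f) := by
  constructor
  · rintro ⟨hf, H⟩
    have hf' : ContDiffOn ℝ (m + 1) f U := by exact_mod_cast hf
    refine ⟨hf', fun i => ⟨contDiffOn_partialDeriv hU hf' i, fun l hl => ?_⟩⟩
    simpa [listDeriv_append, listDeriv] using H (l ++ [i]) (by simp [hl])
  · rintro ⟨hf, H⟩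
    refine ⟨by exact_mod_cast hf, fun l hl => ?_⟩
    obtain ⟨l', i, rfl⟩ : ∃ l' i, l = l' ++ [i] :=
      ⟨_, _, (List.dropLast_append_getLast (by rintro rfl; simp at hl)).symm⟩
    rw [listDeriv_append]
    exact (H i).2 l' (by simpa using hl)

theorem PartialZygmundOn.comp_curve (hU : IsOpen U) {m : ℕ} {f : EuclideanSpace ℝ (Fin d) → ℝ}
    (hf : PartialZygmundOn m U f) {c : ℝ → EuclideanSpace ℝ (Fin d)} (hc : ContDiff ℝ ∞ c)
    (hcU : ∀ t, c t ∈ U) : IsZygmundReal m (f ∘ c) := by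
  induction m generalizing f with
  | zero =>
    rw [isZygmundReal_zero_iff]
    exact (partialZygmundOn_zero_iff.1 hf).comp_curve hU (by exact_mod_cast contDiff_infty.1 hc 2) hcU
  | succ m ih =>
    obtain ⟨h1, h2⟩ := (partialZygmundOn_succ_iff hU).1 hf
    have hfd : ∀ t, DifferentiableAt ℝ f (c t) := fun t =>
      (h1.differentiableOn (by norm_cast) (c t) (hcU t)).differentiableAt (hU.mem_nhds (hcU t))
    have hc1 := contDiff_infty_iff_deriv.1 hc
    have hd : ∀ t, HasDerivAt (f ∘ c) (∑ i, (partialDeriv i f ∘ c) t * deriv c t i) t := by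
      intro t
      have := (hfd t).hasFDerivAt.comp_hasDerivAt t (hc1.1 t).hasDerivAt
      rw [EuclideanSpace.clm_eq_sum_single (fderiv ℝ f (c t))] at this
      simpa [partialDeriv_eq_fderiv (hfd t)] using this
    refine isZygmundReal_succ_iff.2 ⟨fun t => (hd t).differentiableAt, ?_⟩
    rw [funext fun t => (hd t).deriv]
    refine IsZygmundReal.sum _ fun i _ => (ih (h2 i)).mul_contDiff ?_
    exact (contDiff_euclidean.1 hc1.2) i

end Partial

/-! ### Smooth curves through rapidly converging segments. -/

section Curve

variable {E : Type*} [NormedAddCommGroup E] [NormedSpace ℝ E]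

/-- A series of smooth compactly supported functions with rapidly decreasing vector coefficients
is smooth and uniformly small. -/
theorem exists_contDiff_tsum_smul [CompleteSpace E] {φ : ℕ → ℝ → ℝ} (hφ : ∀ n, ContDiff ℝ ∞ (φ n))
    (hc : ∀ n, HasCompactSupport (φ n)) {ρ : ℝ} (hρ : 0 < ρ) :
    ∃ ε : ℕ → ℝ, (∀ n, 0 < ε n) ∧ ∀ a : ℕ → E, (∀ n, ‖a n‖ ≤ ε n) →
      ContDiff ℝ ∞ (fun t => ∑' n, φ n t • a n) ∧ ∀ t, ‖∑' n, φ n t • a n‖ < ρ := by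
  have hB : ∀ n k : ℕ, ∃ B, 0 ≤ B ∧ ∀ t, ‖iteratedFDeriv ℝ k (φ n) t‖ ≤ B := by
    intro n k
    obtain ⟨B, hB⟩ := ((hφ n).continuous_iteratedFDeriv (m := k)
      (by exact_mod_cast le_top)).bounded_above_of_compact_support ((hc n).iteratedFDeriv k)
    exact ⟨B, (norm_nonneg _).trans (hB 0), hB⟩
  choose B hB0 hB using hB
  -- Diagonal choice: `M n` controls only orders up to `n`. For a fixed order `k` this covers all
  -- but finitely many terms, which suffices for smoothness.
  set M : ℕ → ℝ := fun n => ∑ k ∈ Finset.range (n + 1), B n k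
  have hM0 : ∀ n, 0 ≤ M n := fun n => Finset.sum_nonneg fun k _ => hB0 n k
  have hM : ∀ n k t, k ≤ n → ‖iteratedFDeriv ℝ k (φ n) t‖ ≤ M n := fun n k t hk =>
    (hB n k t).trans (Finset.single_le_sum (f := B n) (fun k _ => hB0 n k)
      (Finset.mem_range.2 (Nat.lt_succ_of_le hk)))
  refine ⟨fun n => ρ / 4 * (1 / 2) ^ n / (1 + M n), fun n => ?_, fun a ha => ?_⟩
  · have := hM0 n; positivity
  have hder : ∀ n k t, k ≤ n →
      ‖iteratedFDeriv ℝ k (fun t => φ n t • a n) t‖ ≤ ρ / 4 * (1 / 2) ^ n := by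
    intro n k t hk
    have h1 := (ContinuousLinearMap.toSpanSingleton ℝ (a n)).norm_iteratedFDeriv_comp_left
      (f := φ n) (x := t) (N := ∞) (n := k) (hφ n).contDiffAt (by exact_mod_cast le_top)
    rw [ContinuousLinearMap.norm_toSpanSingleton] at h1
    refine le_trans h1 ?_
    have h2 := ha n
    rw [le_div_iff₀ (by linarith [hM0 n])] at h2
    calc ‖a n‖ * ‖iteratedFDeriv ℝ k (φ n) t‖ ≤ ‖a n‖ * (1 + M n) := by
          gcongr; linarith [hM n k t hk]
      _ ≤ _ := h2
  have hsum : Summable fun n : ℕ => ρ / 4 * (1 / 2 : ℝ) ^ n := summable_geometric_two.mul_left _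
  refine ⟨contDiff_tsum_of_eventually (v := fun _ n => ρ / 4 * (1 / 2 : ℝ) ^ n)
    (fun n => (hφ n).smul contDiff_const) (fun _ _ => hsum) fun k _ => ?_, fun t => ?_⟩
  · rw [Nat.cofinite_eq_atTop]
    filter_upwards [eventually_ge_atTop k] with n hn t using hder n k t hn
  · have := tsum_of_norm_bounded hsum.hasSum fun n => by
      simpa using hder n 0 t (Nat.zero_le n)
    refine this.trans_lt ?_
    rw [tsum_mul_left, tsum_geometric_two]
    linarith

/-- For a rapidly decreasing gauge `ε`, there is a smooth curve that near the times `8 / 2 ^ n` runs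
through given segments of lengths and distances to `x` controlled by `ε n`. -/
theorem exists_curve_through_segments [CompleteSpace E] {ρ : ℝ} (hρ : 0 < ρ) :
    ∃ ε : ℕ → ℝ, (∀ n, 0 < ε n) ∧ ∀ (x : E) (a v : ℕ → E), (∀ n, ‖a n‖ ≤ ε n) →
      (∀ n, ‖v n‖ ≤ ε n) → ∃ c : ℝ → E, ContDiff ℝ ∞ c ∧ (∀ t, dist (c t) x < ρ) ∧ c 0 = x ∧
        ∀ n : ℕ, ∀ s : ℝ, |s| ≤ (1 / 2) ^ n → c (8 * (1 / 2) ^ n + s) = x + a n + s • v n := by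
  -- The support of `ψ n` is `[6, 10]` scaled by `2 ^ (-n)`; these intervals are pairwise disjoint
  -- and avoid `0`. Multiplying `ψ n` by `t - 8 * (1 / 2) ^ n` produces the linear motion with
  -- velocity `v n`.
  let ψ : ∀ n : ℕ, ContDiffBump (8 * (1 / 2 : ℝ) ^ n) := fun n =>
    ⟨(1 / 2) ^ n, 2 * (1 / 2) ^ n, by positivity, by
      have : (0 : ℝ) < (1 / 2) ^ n := by positivity
      linarith⟩
  have hψ0 : ∀ n t, 2 * (1 / 2) ^ n ≤ |t - 8 * (1 / 2) ^ n| → ψ n t = 0 :=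
    fun n t h => (ψ n).zero_of_le_dist h
  have hψ1 : ∀ n s, |s| ≤ (1 / 2) ^ n → ψ n (8 * (1 / 2) ^ n + s) = 1 := fun n s h =>
    (ψ n).one_of_mem_closedBall (by rw [mem_closedBall, dist_self_add_left]; exact h)
  have hs1 : ∀ n, ContDiff ℝ ∞ (ψ n) := fun n => (ψ n).contDiff
  have hs2 : ∀ n : ℕ, ContDiff ℝ ∞ (fun t => (t - 8 * (1 / 2) ^ n) * ψ n t) := fun n =>
    (contDiff_id.sub contDiff_const).mul (hs1 n)
  have hc1 : ∀ n, HasCompactSupport (ψ n) := fun n => (ψ n).hasCompactSupport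
  have hc2 : ∀ n : ℕ, HasCompactSupport (fun t => (t - 8 * (1 / 2) ^ n) * ψ n t) := fun n =>
    (hc1 n).mul_left
  obtain ⟨ε₁, h₁, H₁⟩ := exists_contDiff_tsum_smul (E := E) hs1 hc1 (half_pos hρ)
  obtain ⟨ε₂, h₂, H₂⟩ := exists_contDiff_tsum_smul (E := E) hs2 hc2 (half_pos hρ)
  refine ⟨fun n => min (ε₁ n) (ε₂ n), fun n => lt_min (h₁ n) (h₂ n), fun x a v ha hv => ?_⟩
  obtain ⟨S₁, b₁⟩ := H₁ a fun n => (ha n).trans (min_le_left _ _)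
  obtain ⟨S₂, b₂⟩ := H₂ v fun n => (hv n).trans (min_le_right _ _)
  refine ⟨fun t => x + ∑' n, ψ n t • a n + ∑' n : ℕ, ((t - 8 * (1 / 2) ^ n) * ψ n t) • v n,
    (contDiff_const.add S₁).add S₂, fun t => ?_, ?_, fun n s hs => ?_⟩
  · simp only [dist_eq_norm]
    rw [add_assoc, add_sub_cancel_left]
    refine (norm_add_le _ _).trans_lt ?_
    linarith [b₁ t, b₂ t]
  · have : ∀ n, ψ n 0 = 0 := fun n => hψ0 n 0 (by
      have : (0 : ℝ) < (1 / 2) ^ n := by positivity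
      rw [zero_sub, abs_neg, abs_of_pos (by positivity)]
      linarith)
    simp [this]
  · have hoff : ∀ k, k ≠ n → ψ k (8 * (1 / 2) ^ n + s) = 0 := by
      intro k hk
      apply hψ0
      have p1 : (0 : ℝ) < (1 / 2) ^ n := by positivity
      have p2 : (0 : ℝ) < (1 / 2) ^ k := by positivity
      have hs' := abs_le.1 hs
      rcases lt_or_gt_of_ne hk with hlt | hlt
      · have : (1 / 2 : ℝ) ^ n ≤ (1 / 2) ^ (k + 1) :=
          pow_le_pow_of_le_one (by norm_num) (by norm_num) hlt
        rw [pow_succ] at this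
        rw [abs_sub_comm]
        exact le_trans (by linarith) (le_abs_self _)
      · have : (1 / 2 : ℝ) ^ k ≤ (1 / 2) ^ (n + 1) :=
          pow_le_pow_of_le_one (by norm_num) (by norm_num) hlt
        rw [pow_succ] at this
        exact le_trans (by linarith) (le_abs_self _)
    simp only
    rw [tsum_eq_single n fun k hk => by rw [hoff k hk, zero_smul],
      tsum_eq_single n fun k hk => by rw [hoff k hk, mul_zero, zero_smul], hψ1 n s hs]
    simp

end Curve

/-! ### Finite differences: from curves to the function itself. -/

section Difference

theorem HasDerivAt.fwdDiff_iter {g g' : ℝ → ℝ} (hg : ∀ t, HasDerivAt g (g' t) t) (s : ℝ) (N : ℕ)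
    (t : ℝ) : HasDerivAt ((fwdDiff s)^[N] g) ((fwdDiff s)^[N] g' t) t := by
  induction N generalizing t with
  | zero => exact hg t
  | succ N ih =>
    rw [Function.iterate_succ_apply', Function.iterate_succ_apply']
    exact ((ih (t + s)).comp_add_const t s).sub (ih t)

/-- Differences commute with differentiation, so passing from `g'` to `g` costs one more difference,
and the mean value inequality on `[t, t + s]` gains one factor `s`. The base case is a symmetric
second difference centred at `t + s`. -/
theorem IsZygmundReal.exists_fwdDiff_bound {m : ℕ} {g : ℝ → ℝ} (hg : IsZygmundReal m g) (R : ℝ) :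
    ∃ C, ∀ t s : ℝ, |t| ≤ R → 0 < s → s ≤ 1 → |(fwdDiff s)^[m + 2] g t| ≤ C * s ^ (m + 1) := by
  induction m generalizing g R with
  | zero =>
    obtain ⟨C, hC⟩ := hg.2.2 (Set.Icc (-R - 2) (R + 2)) (Set.subset_univ _) isCompact_Icc
    refine ⟨C, fun t s ht h0 h1 => ?_⟩
    have ht' := abs_le.1 ht
    have := hC (t + s) s h0.ne' ⟨by linarith, by linarith⟩ ⟨by linarith, by linarith⟩
      ⟨by linarith, by linarith⟩
    rw [Real.norm_eq_abs, abs_of_pos h0, div_le_iff₀ h0, iteratedDeriv_zero,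
      add_sub_cancel_right] at this
    have e : (fwdDiff s)^[2] g t = g (t + s + s) - 2 * g (t + s) + g t := by
      simp only [Function.iterate_succ_apply', Function.iterate_zero, id_eq, fwdDiff]
      ring
    simpa [e] using this
  | succ m ih =>
    obtain ⟨h1, h2⟩ := isZygmundReal_succ_iff.1 hg
    obtain ⟨C, hC⟩ := ih h2 (R + 1)
    refine ⟨C, fun t s ht h0 hs => ?_⟩
    have hd := HasDerivAt.fwdDiff_iter (fun t => (h1 t).hasDerivAt) s (m + 2)
    have ht' := abs_le.1 ht
    have := (convex_Icc t (t + s)).norm_image_sub_le_of_norm_hasDerivWithin_le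
      (fun u _ => (hd u).hasDerivWithinAt)
      (fun u hu => hC u s (abs_le.2 ⟨by linarith [hu.1], by linarith [hu.2]⟩) h0 hs)
      (Set.left_mem_Icc.2 (by linarith)) (Set.right_mem_Icc.2 (by linarith))
    rw [add_sub_cancel_left, Real.norm_eq_abs, Real.norm_eq_abs, abs_of_pos h0, mul_assoc,
      ← pow_succ] at this
    rw [Function.iterate_succ_apply']
    exact this

variable {E : Type*} [NormedAddCommGroup E]

theorem fwdDiff_iter_comp_eq {f : E → ℝ} {c : ℝ → E} {t s : ℝ} {y h : E} {N : ℕ}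
    (hc : ∀ k ≤ N, c (t + k • s) = y + k • h) :
    (fwdDiff s)^[N] (f ∘ c) t = (fwdDiff h)^[N] f y := by
  rw [fwdDiff_iter_eq_sum_shift, fwdDiff_iter_eq_sum_shift]
  refine Finset.sum_congr rfl fun k hk => ?_
  rw [Function.comp_apply, hc k (Nat.lt_succ_iff.1 (Finset.mem_range.1 hk))]

/-- Were `f` discontinuous at `x`, points `y n` rapidly approaching `x` with values far from `f x`
would lie on one smooth curve reaching `x` at time `0`; zero velocities suffice. -/
theorem continuousOn_of_comp_curve [NormedSpace ℝ E] [CompleteSpace E] {U : Set E}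
    (hU : IsOpen U) {f : E → ℝ}
    (hf : ∀ c : ℝ → E, ContDiff ℝ ∞ c → (∀ t, c t ∈ U) → Continuous (f ∘ c)) :
    ContinuousOn f U := by
  intro x hx
  refine ContinuousAt.continuousWithinAt ?_
  obtain ⟨ρ, hρ, hρU⟩ := Metric.isOpen_iff.1 hU x hx
  obtain ⟨ε, hε, H⟩ := exists_curve_through_segments (E := E) hρ
  by_contra hcon
  rw [Metric.continuousAt_iff] at hcon
  push Not at hcon
  obtain ⟨η, hη, hy⟩ := hcon
  choose y hy1 hy2 using fun n => hy (ε n) (hε n)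
  obtain ⟨c, hc, hcU, hc0, hcn⟩ := H x (fun n => y n - x) (fun _ => 0)
    (fun n => by rw [← dist_eq_norm]; exact (hy1 n).le) (fun n => by simpa using (hε n).le)
  have hcont := (hf c hc fun t => hρU (hcU t)).continuousAt (x := 0)
  have ht : Tendsto (fun n : ℕ => 8 * (1 / 2 : ℝ) ^ n) atTop (𝓝 0) := by
    simpa using (tendsto_pow_atTop_nhds_zero_of_lt_one (r := (1 / 2 : ℝ))
      (by norm_num) (by norm_num)).const_mul 8
  have hlim := hcont.tendsto.comp ht
  rw [Function.comp_apply, hc0] at hlim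
  obtain ⟨n, hn⟩ := ((Metric.tendsto_nhds.1 hlim) η hη).exists
  have := hcn n 0 (by simp)
  rw [add_zero] at this
  simp only [Function.comp_apply, this] at hn
  have h2 := hy2 n
  simp at hn
  linarith

/-- Bad segments are traversed at speed `ε n`, so the increment `h n` takes time `s = ‖h n‖ / ε n`.
The constant `n / ε n ^ (m + 1)` then becomes exactly `n * s ^ (m + 1)`, contradicting the bound
along the curve. -/
theorem exists_ball_fwdDiff_bound [NormedSpace ℝ E] [CompleteSpace E] {U : Set E}
    (hU : IsOpen U) {f : E → ℝ} {m : ℕ}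
    (hf : ∀ c : ℝ → E, ContDiff ℝ ∞ c → (∀ t, c t ∈ U) → IsZygmundReal m (f ∘ c))
    {x : E} (hx : x ∈ U) :
    ∃ r > 0, ∃ C, 0 ≤ C ∧ ∀ y h, y ∈ ball x r → y + (m + 2) • h ∈ ball x r →
      |(fwdDiff h)^[m + 2] f y| ≤ C * ‖h‖ ^ (m + 1) := by
  obtain ⟨ρ, hρ, hρU⟩ := Metric.isOpen_iff.1 hU x hx
  obtain ⟨ε, hε, H⟩ := exists_curve_through_segments (E := E) hρ
  by_contra hcon
  push Not at hcon
  have hδ : ∀ n : ℕ, (0 : ℝ) < (1 / 2) ^ n := fun n => by positivity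
  have hδ1 : ∀ n : ℕ, (1 / 2 : ℝ) ^ n ≤ 1 := fun n => pow_le_one₀ (by norm_num) (by norm_num)
  -- This radius forces `(m + 2) * ‖h n‖ ≤ ε n * (1 / 2) ^ n`, so all `m + 2` steps fit in the time
  -- window where the curve is straight.
  choose y h hy hyh hbig using fun n : ℕ => hcon (ε n * (1 / 2) ^ n / 2)
    (by have := hε n; have := hδ n; positivity) (n / ε n ^ (m + 1)) (by have := hε n; positivity)
  have hh0 : ∀ n, 0 < ‖h n‖ := by
    intro n
    refine norm_pos_iff.2 fun h0 => ?_
    have := hbig n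
    rw [h0, Function.iterate_succ_apply'] at this
    simp [fwdDiff] at this
  have hNh : ∀ n, (m + 2) * ‖h n‖ ≤ ε n * (1 / 2) ^ n := by
    intro n
    have h1 := dist_triangle_right (y n + (m + 2) • h n) (y n) x
    rw [dist_self_add_left, ← Nat.cast_smul_eq_nsmul ℝ, norm_smul] at h1
    have h2 := mem_ball.1 (hy n)
    have h3 := mem_ball.1 (hyh n)
    rw [← Nat.cast_smul_eq_nsmul ℝ] at h3
    rw [Real.norm_of_nonneg (by positivity)] at h1
    push_cast at *
    linarith
  obtain ⟨c, hc, hcU, -, hcn⟩ := H x (fun n => y n - x) (fun n => (ε n / ‖h n‖) • h n)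
    (fun n => by
      rw [← dist_eq_norm]
      have := mem_ball.1 (hy n)
      nlinarith [hε n, hδ1 n])
    (fun n => by
      rw [norm_smul, Real.norm_of_nonneg (div_pos (hε n) (hh0 n)).le,
        div_mul_cancel₀ _ (hh0 n).ne'])
  obtain ⟨C, hC⟩ := (hf c hc fun t => hρU (hcU t)).exists_fwdDiff_bound 8
  obtain ⟨n, hn⟩ := exists_nat_gt C
  set s := ‖h n‖ / ε n
  have hs : 0 < s := div_pos (hh0 n) (hε n)
  have hNs : (m + 2) * s ≤ (1 / 2) ^ n := by
    rw [← mul_div_assoc, div_le_iff₀ (hε n)]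
    linarith [hNh n]
  have heq : (fwdDiff s)^[m + 2] (f ∘ c) (8 * (1 / 2) ^ n) = (fwdDiff (h n))^[m + 2] f (y n) := by
    refine fwdDiff_iter_comp_eq fun k hk => ?_
    have hk' : (k : ℝ) ≤ m + 2 := by exact_mod_cast hk
    rw [hcn n (k • s) ?_]
    · rw [add_sub_cancel, smul_smul, nsmul_eq_mul, mul_assoc, div_mul_div_cancel₀ (hε n).ne',
        div_self (hh0 n).ne', mul_one, Nat.cast_smul_eq_nsmul]
    · rw [nsmul_eq_mul, abs_of_nonneg (by positivity)]
      exact le_trans (by gcongr) hNs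
  have h1 := hC (8 * (1 / 2) ^ n) s (by rw [abs_of_nonneg (by positivity)]; linarith [hδ1 n]) hs
    (by nlinarith [hδ1 n])
  rw [heq] at h1
  have h2 := (hbig n).trans_le h1
  rw [div_mul_eq_mul_div, mul_div_assoc, ← div_pow] at h2
  have := lt_of_mul_lt_mul_right h2 (by positivity)
  linarith

end Difference

/-! ### Regularity of sums of dyadic series. -/

section Series

variable {d : ℕ}

theorem norm_fderiv_le_of_partialDeriv {f : EuclideanSpace ℝ (Fin d) → ℝ}
    {x : EuclideanSpace ℝ (Fin d)} (hf : DifferentiableAt ℝ f x) {B : ℝ}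
    (hB : ∀ i, |partialDeriv i f x| ≤ B) : ‖fderiv ℝ f x‖ ≤ d * B := by
  rw [EuclideanSpace.clm_eq_sum_single (fderiv ℝ f x)]
  refine (norm_sum_le _ _).trans ?_
  have : ∀ i ∈ (Finset.univ : Finset (Fin d)), ‖fderiv ℝ f x (EuclideanSpace.single i 1) •
      (EuclideanSpace.proj i : EuclideanSpace ℝ (Fin d) →L[ℝ] ℝ)‖ ≤ B := by
    intro i _
    rw [norm_smul, ← partialDeriv_eq_fderiv hf]
    have hp : ‖(EuclideanSpace.proj i : EuclideanSpace ℝ (Fin d) →L[ℝ] ℝ)‖ ≤ 1 :=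
      ContinuousLinearMap.opNorm_le_bound _ zero_le_one fun v => by
        simpa using PiLp.norm_apply_le v i
    calc _ ≤ |partialDeriv i f x| * 1 := by rw [Real.norm_eq_abs]; gcongr
      _ ≤ B := by rw [mul_one]; exact hB i
  simpa using Finset.sum_le_card_nsmul _ _ _ this

theorem abs_sub_le_of_partialDeriv {V : Set (EuclideanSpace ℝ (Fin d))} (hV : Convex ℝ V)
    {f : EuclideanSpace ℝ (Fin d) → ℝ} (hf : Differentiable ℝ f) {B : ℝ}
    (hB : ∀ x ∈ V, ∀ i, |partialDeriv i f x| ≤ B) {x y : EuclideanSpace ℝ (Fin d)} (hx : x ∈ V)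
    (hy : y ∈ V) : |f y - f x| ≤ d * B * ‖y - x‖ :=
  hV.norm_image_sub_le_of_norm_fderiv_le (fun z _ => hf z)
    (fun z hz => norm_fderiv_le_of_partialDeriv (hf z) (hB z hz)) hx hy

theorem partialDeriv_comp_add {f : EuclideanSpace ℝ (Fin d) → ℝ} (h x : EuclideanSpace ℝ (Fin d))
    (i : Fin d) : partialDeriv i (fun z => f (z + h)) x = partialDeriv i f (x + h) := by
  simp only [partialDeriv, lineDeriv]
  congr 1
  funext t
  rw [add_right_comm]

theorem partialDeriv_sub {f g : EuclideanSpace ℝ (Fin d) → ℝ} (hf : Differentiable ℝ f)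
    (hg : Differentiable ℝ g) (i : Fin d) :
    partialDeriv i (fun x => f x - g x) = fun x => partialDeriv i f x - partialDeriv i g x := by
  funext x
  rw [partialDeriv_eq_fderiv ((hf x).fun_sub (hg x)), partialDeriv_eq_fderiv (hf x),
    partialDeriv_eq_fderiv (hg x), fderiv_fun_sub (hf x) (hg x)]
  rfl

theorem contDiff_partialDeriv {f : EuclideanSpace ℝ (Fin d) → ℝ} (hf : ContDiff ℝ ∞ f)
    (i : Fin d) : ContDiff ℝ ∞ (partialDeriv i f) := by
  have h := contDiff_infty_iff_fderiv.1 hf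
  rw [show partialDeriv i f = fun x => fderiv ℝ f x (EuclideanSpace.single i 1) from
    funext fun x => partialDeriv_eq_fderiv (h.1 x) i]
  exact h.2.clm_apply contDiff_const

theorem contDiff_listDeriv {f : EuclideanSpace ℝ (Fin d) → ℝ} (hf : ContDiff ℝ ∞ f)
    (l : List (Fin d)) : ContDiff ℝ ∞ (listDeriv l f) := by
  induction l with
  | nil => exact hf
  | cons i l ih => exact contDiff_partialDeriv ih i

/-- The second difference is the increment from `y - h` to `y` of `f (z + h) - f z`; the mean value
inequality is applied to this function and to the first derivatives of `f`. -/
theorem abs_second_difference_le {V : Set (EuclideanSpace ℝ (Fin d))} (hV : Convex ℝ V)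
    {f : EuclideanSpace ℝ (Fin d) → ℝ} (hf : ContDiff ℝ ∞ f) {B : ℝ}
    (hB : ∀ x ∈ V, ∀ i j, |partialDeriv i (partialDeriv j f) x| ≤ B)
    {y h : EuclideanSpace ℝ (Fin d)} (h1 : y ∈ V) (h2 : y + h ∈ V) (h3 : y - h ∈ V) :
    |f (y + h) - 2 * f y + f (y - h)| ≤ d * (d * B) * ‖h‖ ^ 2 := by
  have hfd := (contDiff_infty_iff_fderiv.1 hf).1
  have hfh : Differentiable ℝ (fun z => f (z + h)) := hfd.comp (differentiable_id.add_const h)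
  have hG : ∀ z ∈ V ∩ (fun z => z + h) ⁻¹' V, ∀ i,
      |partialDeriv i (fun z => f (z + h) - f z) z| ≤ d * B * ‖h‖ := by
    rintro z ⟨hz, hzh⟩ i
    rw [partialDeriv_sub hfh hfd]
    simp only [partialDeriv_comp_add]
    have := abs_sub_le_of_partialDeriv hV
      ((contDiff_infty_iff_fderiv.1 (contDiff_partialDeriv hf i)).1)
      (fun x hx j => hB x hx j i) hz hzh
    simpa using this
  have := abs_sub_le_of_partialDeriv (hV.inter (hV.translate_preimage_left h)) (hfh.sub hfd) hG
    (x := y - h) (y := y) ⟨h3, by simpa using h1⟩ ⟨h1, h2⟩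
  simp only [Pi.sub_apply, sub_add_cancel, sub_sub_cancel] at this
  calc _ = |f (y + h) - f y - (f y - f (y - h))| := by congr 1; ring
    _ ≤ d * (d * B * ‖h‖) * ‖h‖ := this
    _ = _ := by ring

theorem tsum_le_of_dyadic_bounds {a : ℕ → ℝ} {A B t : ℝ} (hA : 0 ≤ A) (hB : 0 ≤ B) (ht0 : 0 < t)
    (ht1 : t ≤ 1) (ha0 : ∀ j, 0 ≤ a j) (ha1 : ∀ j, a j ≤ A * (1 / 2) ^ j)
    (ha2 : ∀ j, a j ≤ B * 2 ^ j * t ^ 2) : ∑' j, a j ≤ (2 * A + 2 * B) * t := by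
  -- The cut `2 ^ (-(J + 1)) < t ≤ 2 ^ (-J)` balances the two bounds: the growing one is summed up
  -- to `J`, the decaying one beyond.
  obtain ⟨J, hJ1, hJ2⟩ := exists_nat_pow_near_of_lt_one ht0 ht1 (by norm_num : (0 : ℝ) < 1 / 2)
    (by norm_num)
  have hg : Summable fun j : ℕ => A * (1 / 2 : ℝ) ^ j := summable_geometric_two.mul_left _
  have hs : Summable a := .of_nonneg_of_le ha0 ha1 hg
  rw [← hs.sum_add_tsum_nat_add (J + 1)]
  have e1 : ∑ j ∈ Finset.range (J + 1), a j ≤ 2 * B * t := by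
    calc _ ≤ ∑ j ∈ Finset.range (J + 1), B * 2 ^ j * t ^ 2 := Finset.sum_le_sum fun j _ => ha2 j
      _ = B * t ^ 2 * (2 ^ (J + 1) - 1) := by
        rw [← Finset.sum_mul, ← Finset.mul_sum, geom_sum_eq (by norm_num)]; ring
      _ ≤ B * t ^ 2 * 2 ^ (J + 1) := by gcongr; linarith
      _ = 2 * B * t * (t * 2 ^ J) := by ring
      _ ≤ 2 * B * t * 1 := by
        gcongr
        rw [one_div, inv_pow] at hJ2
        rwa [← le_div_iff₀ (by positivity), one_div]
      _ = _ := mul_one _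
  have e2 : ∑' j, a (j + (J + 1)) ≤ 2 * A * t := by
    calc _ ≤ ∑' j : ℕ, A * (1 / 2 : ℝ) ^ (J + 1) * (1 / 2) ^ j := by
          refine ((summable_nat_add_iff (J + 1)).2 hs).tsum_le_tsum (fun j => ?_)
            (summable_geometric_two.mul_left _)
          refine (ha1 _).trans (le_of_eq ?_)
          rw [pow_add]; ring
      _ = 2 * A * (1 / 2 : ℝ) ^ (J + 1) := by rw [tsum_mul_left, tsum_geometric_two]; ring
      _ ≤ _ := by gcongr
  linarith

/-- Each term contributes a second difference bounded by a multiple of `min (2 ^ (-j)) (2 ^ j * ‖h‖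
^ 2)`, from the bounds for derivatives of order zero and two. -/
theorem locallyZygmundOn_of_dyadic_series {V : Set (EuclideanSpace ℝ (Fin d))} (hV : IsOpen V)
    {w : ℕ → EuclideanSpace ℝ (Fin d) → ℝ} (hw : ∀ j, ContDiff ℝ ∞ (w j))
    (hb : ∀ l : List (Fin d), ∃ A, 0 ≤ A ∧ ∀ j, ∀ x ∈ V,
      |listDeriv l (w j) x| ≤ A * (2 ^ j) ^ l.length / 2 ^ j)
    {f : EuclideanSpace ℝ (Fin d) → ℝ} (hf : ∀ x ∈ V, HasSum (fun j => w j x) (f x)) :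
    LocallyZygmundOn V f := by
  obtain ⟨A, hA, H0⟩ := hb []
  have H0 : ∀ j, ∀ x ∈ V, |w j x| ≤ A * (1 / 2) ^ j := by
    intro j x hx
    simpa [listDeriv, div_eq_mul_inv] using H0 j x hx
  choose B hB0 hB using fun p : Fin d × Fin d => hb [p.1, p.2]
  set B' := ∑ p, B p
  have hB' : 0 ≤ B' := Finset.sum_nonneg fun p _ => hB0 p
  have H2 : ∀ j, ∀ x ∈ V, ∀ i k, |partialDeriv i (partialDeriv k (w j)) x| ≤ B' * 2 ^ j := by
    intro j x hx i k
    refine (hB (i, k) j x hx).trans ?_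
    have : B (i, k) ≤ B' := Finset.single_le_sum (f := B) (fun p _ => hB0 p) (Finset.mem_univ _)
    rw [List.length_cons, List.length_singleton, mul_div_assoc, sq, mul_self_div_self]
    gcongr
  have hg : Summable fun j : ℕ => A * (1 / 2 : ℝ) ^ j := summable_geometric_two.mul_left _
  refine ⟨?_, fun x hx => ?_⟩
  · refine ContinuousOn.congr (f := fun x => ∑' j, w j x) ?_ fun x hx => (hf x hx).tsum_eq.symm
    exact continuousOn_tsum (fun j => (hw j).continuous.continuousOn) hg H0
  · obtain ⟨r, hr, hrV⟩ := Metric.isOpen_iff.1 hV x hx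
    have hsV : ball x (min r (1 / 2)) ⊆ V := (ball_subset_ball (min_le_left _ _)).trans hrV
    refine ⟨min r (1 / 2), by positivity, 2 * (4 * A) + 2 * (d * (d * B')), by positivity,
      fun y h h1 h2 h3 => ?_⟩
    rcases eq_or_ne h 0 with rfl | h0
    · simp; ring_nf
    have ht1 : ‖h‖ ≤ 1 := by
      have := dist_triangle_right (y + h) y x
      rw [dist_self_add_left] at this
      have h1' := (mem_ball.1 h1).trans_le (min_le_right _ _)
      have h2' := (mem_ball.1 h2).trans_le (min_le_right _ _)
      linarith
    have hsum := (((hf _ (hsV h2)).sub ((hf _ (hsV h1)).mul_left 2)).add (hf _ (hsV h3)))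
    have a1 : ∀ j, |w j (y + h) - 2 * w j y + w j (y - h)| ≤ 4 * A * (1 / 2) ^ j := by
      intro j
      have b1 := abs_le.1 (H0 j _ (hsV h1))
      have b2 := abs_le.1 (H0 j _ (hsV h2))
      have b3 := abs_le.1 (H0 j _ (hsV h3))
      exact abs_le.2 ⟨by linarith, by linarith⟩
    have a2 : ∀ j, |w j (y + h) - 2 * w j y + w j (y - h)| ≤ d * (d * B') * 2 ^ j * ‖h‖ ^ 2 := by
      intro j
      refine (abs_second_difference_le (convex_ball x (min r (1 / 2))) (hw j)
        (fun z hz i k => H2 j z (hsV hz) i k) h1 h2 h3).trans (le_of_eq (by ring))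
    rw [← hsum.tsum_eq]
    have hsa : Summable fun j => ‖w j (y + h) - 2 * w j y + w j (y - h)‖ :=
      .of_nonneg_of_le (fun _ => norm_nonneg _) a1 (summable_geometric_two.mul_left _)
    refine (norm_tsum_le_tsum_norm hsa).trans ?_
    exact tsum_le_of_dyadic_bounds (by positivity) (by positivity) (norm_pos_iff.2 h0) ht1
      (fun j => abs_nonneg _) a1 a2

/-- One derivative costs a factor `2 ^ j`, so the terms `∂_i w_j` satisfy the hypothesis for the
next lower `m`. While `m` is positive the gradients are `O(2 ^ (-j))`, which justifies termwise
differentiation. -/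
theorem partialZygmundOn_of_dyadic_series {V : Set (EuclideanSpace ℝ (Fin d))} (hV : IsOpen V)
    (hVc : Convex ℝ V) {m : ℕ} {w : ℕ → EuclideanSpace ℝ (Fin d) → ℝ}
    (hw : ∀ j, ContDiff ℝ ∞ (w j))
    (hb : ∀ l : List (Fin d), ∃ A, 0 ≤ A ∧ ∀ j, ∀ x ∈ V,
      |listDeriv l (w j) x| ≤ A * (2 ^ j) ^ l.length / (2 ^ j) ^ (m + 1))
    {f : EuclideanSpace ℝ (Fin d) → ℝ} (hf : ∀ x ∈ V, HasSum (fun j => w j x) (f x)) :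
    PartialZygmundOn m V f := by
  induction m generalizing w f with
  | zero =>
    exact partialZygmundOn_zero_iff.2
      (locallyZygmundOn_of_dyadic_series hV hw (by simpa using hb) hf)
  | succ m ih =>
    have hb' : ∀ i, ∀ l : List (Fin d), ∃ A, 0 ≤ A ∧ ∀ j, ∀ x ∈ V,
        |listDeriv l (partialDeriv i (w j)) x| ≤ A * (2 ^ j) ^ l.length / (2 ^ j) ^ (m + 1) := by
      intro i l
      obtain ⟨A, hA, H⟩ := hb (l ++ [i])
      refine ⟨A, hA, fun j x hx => ?_⟩
      have := H j x hx
      rw [listDeriv_append, List.length_append, List.length_singleton, pow_succ, pow_succ,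
        ← mul_assoc, mul_div_mul_right _ _ (by positivity)] at this
      exact this
    choose A hA0 hA using fun i => hb' i []
    have hbd : ∀ j, ∀ x ∈ V, ∀ i, |partialDeriv i (w j) x| ≤ (∑ i, A i) * (1 / 2) ^ j := by
      intro j x hx i
      refine (hA i j x hx).trans ?_
      have h1 : A i ≤ ∑ i, A i := Finset.single_le_sum (fun p _ => hA0 p) (Finset.mem_univ _)
      have h2 : (1 : ℝ) ≤ 2 ^ j := one_le_pow₀ (by norm_num)
      have h3 : (2 : ℝ) ^ j ≤ (2 ^ j) ^ (m + 1) := le_self_pow₀ h2 (by simp)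
      have h4 := hA0 i
      rw [List.length_nil, pow_zero, mul_one, one_div, inv_pow, ← div_eq_mul_inv]
      gcongr
      exact h4.trans h1
    have hfd : ∀ j, Differentiable ℝ (w j) := fun j => (contDiff_infty_iff_fderiv.1 (hw j)).1
    have hu : Summable fun j : ℕ => d * ((∑ i, A i) * (1 / 2 : ℝ) ^ j) :=
      (summable_geometric_two.mul_left _).mul_left _
    have hn : ∀ j, ∀ x ∈ V, ‖fderiv ℝ (w j) x‖ ≤ d * ((∑ i, A i) * (1 / 2 : ℝ) ^ j) :=
      fun j x hx => norm_fderiv_le_of_partialDeriv (hfd j x) (hbd j x hx)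
    have hder : ∀ x ∈ V, HasFDerivAt f (∑' j, fderiv ℝ (w j) x) x := by
      intro x hx
      have := hasFDerivAt_tsum_of_isPreconnected hu hV hVc.isPreconnected
        (fun j y _ => (hfd j y).hasFDerivAt) hn hx (hf x hx).summable hx
      refine this.congr_of_eventuallyEq ?_
      filter_upwards [hV.mem_nhds hx] with y hy using (hf y hy).tsum_eq.symm
    have hpd : ∀ i, ∀ x ∈ V, HasSum (fun j => partialDeriv i (w j) x) (partialDeriv i f x) := by
      intro i x hx
      have hs : Summable fun j => fderiv ℝ (w j) x := .of_norm_bounded hu fun j => hn j x hx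
      rw [partialDeriv_eq_fderiv (hder x hx).differentiableAt, (hder x hx).fderiv]
      have := hs.hasSum.mapL
        (ContinuousLinearMap.apply ℝ ℝ (EuclideanSpace.single i (1 : ℝ) : EuclideanSpace ℝ (Fin d)))
      simpa [← partialDeriv_eq_fderiv (hfd _ x)] using this
    have hi : ∀ i, PartialZygmundOn m V (partialDeriv i f) := fun i =>
      ih (fun j => contDiff_partialDeriv (hw j) i) (hb' i) (hpd i)
    exact (partialZygmundOn_succ_iff hV).2 ⟨contDiffOn_succ_of_partialDeriv hV
      (fun x hx => (hder x hx).differentiableAt.differentiableWithinAt) fun i => (hi i).1, hi⟩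

end Series

/-! ### Smoothing operators adapted to higher differences. -/

section Smoothing

variable {d : ℕ}

/-- Smooth functions supported in the closed ball of radius `R` around the origin. -/
structure IsSmoothKernel (R : ℝ) (K : EuclideanSpace ℝ (Fin d) → ℝ) : Prop where
  contDiff : ContDiff ℝ ∞ K
  eq_zero : ∀ z, R < ‖z‖ → K z = 0

/-- The dilation of a kernel that preserves its integral. -/
def dilate (ε : ℝ) (K : EuclideanSpace ℝ (Fin d) → ℝ) : EuclideanSpace ℝ (Fin d) → ℝ :=
  fun y => (ε ^ d)⁻¹ * K (ε⁻¹ • y)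

/-- The convolution of `F` with the dilation of `K` by `ε`. -/
def smoothing (K : EuclideanSpace ℝ (Fin d) → ℝ) (ε : ℝ) (F : EuclideanSpace ℝ (Fin d) → ℝ) :
    EuclideanSpace ℝ (Fin d) → ℝ :=
  fun x => ∫ z, F (x - ε • z) * K z

variable {R : ℝ} {K F G : EuclideanSpace ℝ (Fin d) → ℝ} {ε : ℝ}

theorem integral_mul_dilate (hε : 0 < ε) (G K : EuclideanSpace ℝ (Fin d) → ℝ) :
    ∫ y, G y * dilate ε K y = ∫ z, G (ε • z) * K z := by
  have h := Measure.integral_comp_inv_smul_of_nonneg volume (fun z => G (ε • z) * K z) hε.le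
  rw [finrank_euclideanSpace_fin] at h
  simp only [smul_inv_smul₀ hε.ne', smul_eq_mul] at h
  simp only [dilate, mul_left_comm (G _)]
  rw [integral_const_mul, h, inv_mul_cancel_left₀ (by positivity)]

theorem smoothing_eq_convolution (hε : 0 < ε) :
    smoothing K ε F = F ⋆[ContinuousLinearMap.mul ℝ ℝ] dilate ε K := by
  funext x
  rw [convolution_mul_swap, integral_mul_dilate hε (fun t => F (x - t))]
  rfl

namespace IsSmoothKernel

theorem hasCompactSupport (hK : IsSmoothKernel R K) : HasCompactSupport K :=
  HasCompactSupport.intro (isCompact_closedBall 0 R) fun z hz =>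
    hK.eq_zero z (by simpa using hz)

theorem integrable_self (hK : IsSmoothKernel R K) : Integrable K :=
  hK.contDiff.continuous.integrable_of_hasCompactSupport hK.hasCompactSupport

theorem dilate (hK : IsSmoothKernel R K) (hε : 0 < ε) : IsSmoothKernel (ε * R) (dilate ε K) where
  contDiff := contDiff_const.mul (hK.contDiff.comp (contDiff_const_smul _))
  eq_zero z hz := by
    have : K (ε⁻¹ • z) = 0 := hK.eq_zero _ (by
      rwa [norm_smul, norm_inv, Real.norm_of_nonneg hε.le, ← div_eq_inv_mul, lt_div_iff₀' hε])
    rw [_root_.dilate, this, mul_zero]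

theorem mono {R' : ℝ} (hK : IsSmoothKernel R K) (h : R ≤ R') : IsSmoothKernel R' K :=
  ⟨hK.contDiff, fun z hz => hK.eq_zero z (h.trans_lt hz)⟩

theorem partialDeriv (hK : IsSmoothKernel R K) (i : Fin d) :
    IsSmoothKernel R (partialDeriv i K) where
  contDiff := contDiff_partialDeriv hK.contDiff i
  eq_zero z hz := by
    have hopen : IsOpen {z : EuclideanSpace ℝ (Fin d) | R < ‖z‖} :=
      isOpen_lt continuous_const continuous_norm
    rw [partialDeriv_congr hopen (g := fun _ => 0) (fun y hy => hK.eq_zero y hy) i hz,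
      partialDeriv_eq_fderiv (by fun_prop)]
    simp

theorem listDeriv (hK : IsSmoothKernel R K) (l : List (Fin d)) :
    IsSmoothKernel R (listDeriv l K) := by
  induction l with
  | nil => exact hK
  | cons i l ih => exact ih.partialDeriv i

theorem integrable (hK : IsSmoothKernel R K) (hF : Continuous F)
    (x : EuclideanSpace ℝ (Fin d)) (ε : ℝ) : Integrable fun z => F (x - ε • z) * K z :=
  Continuous.integrable_of_hasCompactSupport
    ((hF.comp (by fun_prop)).mul hK.contDiff.continuous) hK.hasCompactSupport.mul_left

theorem contDiff_smoothing (hK : IsSmoothKernel R K) (hF : Continuous F) (hε : 0 < ε) :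
    ContDiff ℝ ∞ (smoothing K ε F) := by
  rw [smoothing_eq_convolution hε]
  exact (hK.dilate hε).hasCompactSupport.contDiff_convolution_right _ hF.locallyIntegrable
    (hK.dilate hε).contDiff

/-- In convolution form the derivative falls on the dilated kernel, hence the factor `ε⁻¹`; `F` need
only be continuous. -/
theorem partialDeriv_smoothing (hK : IsSmoothKernel R K) (hF : Continuous F) (hε : 0 < ε)
    (i : Fin d) :
    _root_.partialDeriv i (smoothing K ε F) =
      fun x => ε⁻¹ * smoothing (_root_.partialDeriv i K) ε F x := by
  funext x
  rw [smoothing_eq_convolution hε, smoothing_eq_convolution hε]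
  have hD := hK.dilate hε
  have hKd := (contDiff_infty_iff_fderiv.1 hK.contDiff).1
  have h := hD.hasCompactSupport.hasFDerivAt_convolution_right (ContinuousLinearMap.mul ℝ ℝ)
    (μ := volume) hF.locallyIntegrable
    (hD.contDiff.of_le (by exact_mod_cast le_top)) x
  rw [partialDeriv_eq_fderiv h.differentiableAt, h.fderiv, convolution_precompR_apply _
    hF.locallyIntegrable (hD.hasCompactSupport.fderiv ℝ)
    (hD.contDiff.continuous_fderiv (by simp))]
  have hfd : (fun a => fderiv ℝ (_root_.dilate ε K) a (EuclideanSpace.single i 1)) =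
      ε⁻¹ • _root_.dilate ε (_root_.partialDeriv i K) := by
    funext a
    have h1 : HasFDerivAt (fun y : EuclideanSpace ℝ (Fin d) => ε⁻¹ • y)
        (ε⁻¹ • ContinuousLinearMap.id ℝ (EuclideanSpace ℝ (Fin d))) a :=
      (hasFDerivAt_id a).const_smul ε⁻¹
    have h2 := (((hKd (ε⁻¹ • a)).hasFDerivAt.comp a h1).const_mul (ε ^ d)⁻¹).fderiv
    have h3 : fderiv ℝ (_root_.dilate ε K) a = _ := h2
    rw [h3, Pi.smul_apply, _root_.dilate, partialDeriv_eq_fderiv (hKd _)]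
    simp
    ring
  rw [hfd, convolution_smul]
  rfl

theorem listDeriv_smoothing (hK : IsSmoothKernel R K) (hF : Continuous F) (hε : 0 < ε)
    (l : List (Fin d)) :
    _root_.listDeriv l (smoothing K ε F) =
      fun x => ε⁻¹ ^ l.length * smoothing (_root_.listDeriv l K) ε F x := by
  induction l with
  | nil => funext x; simp [_root_.listDeriv]
  | cons i l ih =>
    have hl := hK.listDeriv l
    have hd := (contDiff_infty_iff_fderiv.1 (hl.contDiff_smoothing hF hε)).1
    change _root_.partialDeriv i (_root_.listDeriv l (smoothing K ε F)) = _
    rw [ih]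
    funext x
    rw [partialDeriv_eq_fderiv ((hd x).const_mul _), fderiv_const_mul (hd x)]
    have e := congrFun (hl.partialDeriv_smoothing hF hε i) x
    rw [partialDeriv_eq_fderiv (hd x)] at e
    change ε⁻¹ ^ l.length * fderiv ℝ (smoothing (_root_.listDeriv l K) ε F) x
      (EuclideanSpace.single i 1) = _
    rw [e, List.length_cons, pow_succ, mul_assoc]
    rfl

theorem abs_smoothing_le (hK : IsSmoothKernel R K) (hε : 0 ≤ ε) {A : ℝ}
    {x : EuclideanSpace ℝ (Fin d)} (hA : ∀ y, dist y x ≤ ε * R → |F y| ≤ A) :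
    |smoothing K ε F x| ≤ A * ∫ z, |K z| := by
  rw [← integral_const_mul, smoothing, ← Real.norm_eq_abs]
  refine norm_integral_le_of_norm_le
    (hK.integrable_self.abs.const_mul A)
    (Eventually.of_forall fun z => ?_)
  rw [norm_mul, Real.norm_eq_abs, Real.norm_eq_abs]
  rcases lt_or_ge R ‖z‖ with h | h
  · simp [hK.eq_zero z h]
  · gcongr
    apply hA
    rw [dist_self_sub_left, norm_smul, Real.norm_of_nonneg hε]
    gcongr

theorem smoothing_sub (hK : IsSmoothKernel R K) (hF : Continuous F) (hG : Continuous G) (ε : ℝ)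
    (x : EuclideanSpace ℝ (Fin d)) :
    smoothing K ε (fun y => F y - G y) x = smoothing K ε F x - smoothing K ε G x := by
  rw [smoothing, smoothing, smoothing,
    ← integral_sub (hK.integrable hF x ε) (hK.integrable hG x ε)]
  simp only [sub_mul]

/-- Fubini's theorem. Commutation is what makes the difference of two squared smoothings factor in
the telescoping sum. -/
theorem smoothing_comm (hK : IsSmoothKernel R K) (hF : Continuous F) (ε δ : ℝ)
    (x : EuclideanSpace ℝ (Fin d)) :
    smoothing K ε (smoothing K δ F) x = smoothing K δ (smoothing K ε F) x := by
  have hKc := hK.contDiff.continuous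
  simp only [smoothing, ← integral_mul_const]
  rw [integral_integral_swap_of_hasCompactSupport]
  · congr 1; funext w
    congr 1; funext z
    rw [sub_right_comm]; ring
  · unfold Function.uncurry; fun_prop
  · refine HasCompactSupport.intro
      ((isCompact_closedBall (0 : EuclideanSpace ℝ (Fin d)) R).prod (isCompact_closedBall 0 R))
      fun p hp => ?_
    rw [Set.mem_prod, not_and_or] at hp
    rcases hp with hp | hp
    · simp [Function.uncurry, hK.eq_zero p.1 (by simpa using hp)]
    · simp [Function.uncurry, hK.eq_zero p.2 (by simpa using hp)]

end IsSmoothKernel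

theorem fwdDiff_iter_eq_sub_sum {E : Type*} [AddCommGroup E] (F : E → ℝ) (N : ℕ) (x h : E) :
    (fwdDiff h)^[N] F x = (-1) ^ N * (F x - ∑ k ∈ Finset.range N,
      (-1) ^ k * (N.choose (k + 1) : ℝ) * F (x + (k + 1) • h)) := by
  rw [fwdDiff_iter_eq_sum_shift, Finset.sum_range_succ', mul_sub, Finset.mul_sum, sub_eq_add_neg,
    add_comm, ← Finset.sum_neg_distrib]
  congr 1
  · simp
  · refine Finset.sum_congr rfl fun k hk => ?_
    obtain ⟨j, rfl⟩ := Nat.exists_eq_add_of_lt (Finset.mem_range.1 hk)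
    have h1 : ((-1 : ℝ) ^ k) * (-1) ^ k = 1 := by rw [← mul_pow]; simp
    rw [show k + j + 1 - (k + 1) = j by omega, zsmul_eq_mul]
    push_cast
    rw [pow_succ, pow_add]
    linear_combination (-(-1 : ℝ) ^ j * ((k + j + 1).choose (k + 1) : ℝ) *
      F (x + (k + 1) • h)) * h1

/-- A smoothing kernel whose approximation error is controlled by differences of order `N`. -/
theorem exists_isSmoothKernel_abs_sub_le (N : ℕ) :
    ∃ K : EuclideanSpace ℝ (Fin d) → ℝ, IsSmoothKernel N K ∧
      ∀ (F : EuclideanSpace ℝ (Fin d) → ℝ) (ε C : ℝ) (x : EuclideanSpace ℝ (Fin d)),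
        Continuous F → (∀ z, ‖z‖ ≤ 1 → |(fwdDiff (-(ε • z)))^[N] F x| ≤ C) →
          |smoothing K ε F x - F x| ≤ C := by
  let b : ContDiffBump (0 : EuclideanSpace ℝ (Fin d)) := ⟨1 / 2, 1, by norm_num, by norm_num⟩
  obtain ⟨φ, hφ⟩ : ∃ φ, φ = b.normed volume := ⟨_, rfl⟩
  have hφK : IsSmoothKernel 1 φ := by
    refine ⟨hφ ▸ b.contDiff_normed, fun z hz => ?_⟩
    rw [hφ, ← Function.notMem_support, b.support_normed_eq]
    simpa using hz.le
  have hφ0 : ∀ z, 0 ≤ φ z := fun z => hφ ▸ b.nonneg_normed z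
  have hφ1 : ∫ z, φ z = 1 := hφ ▸ b.integral_normed
  have hD : ∀ k ∈ Finset.range N, IsSmoothKernel N (dilate (k + 1) φ) := fun k hk =>
    (hφK.dilate (by positivity)).mono (by
      rw [mul_one]; exact_mod_cast Finset.mem_range.1 hk)
  -- The coefficients are those of `fwdDiff_iter_eq_sub_sum`, and dilating by `k + 1` turns `ε • z`
  -- into `(k + 1) • (ε • z)`. Up to sign, the error is the `φ`-average of the `N`-th differences of
  -- `F` with steps `-(ε • z)`.
  refine ⟨fun z => ∑ k ∈ Finset.range N,
    (-1) ^ k * (N.choose (k + 1) : ℝ) * dilate (k + 1) φ z, ⟨?_, ?_⟩, fun F ε C x hF hC => ?_⟩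
  · exact ContDiff.sum fun k hk => contDiff_const.mul (hD k hk).contDiff
  · exact fun z hz => Finset.sum_eq_zero fun k hk => by rw [(hD k hk).eq_zero z hz, mul_zero]
  · have hint : ∀ k : ℕ, Integrable fun z => F (x + (k + 1) • -(ε • z)) * φ z := by
      intro k
      exact Continuous.integrable_of_hasCompactSupport
        ((hF.comp (by fun_prop)).mul hφK.contDiff.continuous) hφK.hasCompactSupport.mul_left
    have hint' : Integrable fun z => F x * φ z :=
      hφK.integrable_self.const_mul _
    have key : smoothing (fun z => ∑ k ∈ Finset.range N,
        (-1) ^ k * (N.choose (k + 1) : ℝ) * dilate (k + 1) φ z) ε F x - F x =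
        ∫ z, (∑ k ∈ Finset.range N, (-1) ^ k * (N.choose (k + 1) : ℝ) *
          F (x + (k + 1) • -(ε • z)) - F x) * φ z := by
      have e1 : ∀ k : ℕ, ∫ z, F (x - ε • z) * dilate (k + 1) φ z =
          ∫ z, F (x + (k + 1) • -(ε • z)) * φ z := by
        intro k
        rw [integral_mul_dilate (by positivity) (fun z => F (x - ε • z))]
        congr 1; funext z
        rw [smul_comm, sub_eq_add_neg, ← smul_neg, ← Nat.cast_smul_eq_nsmul ℝ]
        push_cast; rfl
      simp only [smoothing, Finset.mul_sum, sub_mul, Finset.sum_mul]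
      rw [integral_finsetSum, integral_sub, integral_finsetSum, integral_const_mul, hφ1, mul_one]
      · congr 1
        refine Finset.sum_congr rfl fun k hk => ?_
        simp only [mul_left_comm (F _), mul_assoc]
        rw [integral_const_mul, integral_const_mul, integral_const_mul, integral_const_mul, e1]
      · intro k _
        simpa only [mul_assoc] using (hint k).const_mul ((-1) ^ k * (N.choose (k + 1) : ℝ))
      · refine integrable_finsetSum _ fun k _ => ?_
        simpa only [mul_assoc] using (hint k).const_mul ((-1) ^ k * (N.choose (k + 1) : ℝ))
      · exact hint'
      · intro k hk
        simpa only [mul_left_comm] using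
          ((hD k hk).integrable hF x ε).const_mul ((-1) ^ k * (N.choose (k + 1) : ℝ))
    rw [key, show C = ∫ z, C * φ z by rw [integral_const_mul, hφ1, mul_one],
      ← Real.norm_eq_abs]
    refine norm_integral_le_of_norm_le
      (hφK.integrable_self.const_mul C)
      (Eventually.of_forall fun z => ?_)
    rw [norm_mul, Real.norm_of_nonneg (hφ0 z)]
    rcases lt_or_ge 1 ‖z‖ with h | h
    · simp [hφK.eq_zero z h]
    · have := hC z h
      rw [fwdDiff_iter_eq_sub_sum, abs_mul, abs_pow, abs_neg, abs_one, one_pow, one_mul,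
        abs_sub_comm] at this
      exact mul_le_mul_of_nonneg_right this (hφ0 z)

end Smoothing

/-! ### Dyadic decomposition and conclusion. -/

section Main

variable {d : ℕ}

theorem listDeriv_add {f g : EuclideanSpace ℝ (Fin d) → ℝ} (hf : ContDiff ℝ ∞ f)
    (hg : ContDiff ℝ ∞ g) (l : List (Fin d)) :
    listDeriv l (fun x => f x + g x) = fun x => listDeriv l f x + listDeriv l g x := by
  induction l with
  | nil => rfl
  | cons i l ih =>
    have h1 := (contDiff_infty_iff_fderiv.1 (contDiff_listDeriv hf l)).1
    have h2 := (contDiff_infty_iff_fderiv.1 (contDiff_listDeriv hg l)).1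
    change partialDeriv i (listDeriv l _) = fun x =>
      partialDeriv i (listDeriv l f) x + partialDeriv i (listDeriv l g) x
    rw [ih]
    funext x
    rw [partialDeriv_eq_fderiv ((h1 x).fun_add (h2 x)), partialDeriv_eq_fderiv (h1 x),
      partialDeriv_eq_fderiv (h2 x), fderiv_fun_add (h1 x) (h2 x)]
    rfl

/-- A continuous function whose differences of order `m + 2` with increment `h` are
`O(‖h‖ ^ (m + 1))` is locally the sum of a dyadic series of smooth functions. -/
theorem exists_dyadic_series {F : EuclideanSpace ℝ (Fin d) → ℝ} (hF : Continuous F) {m : ℕ}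
    {x₀ : EuclideanSpace ℝ (Fin d)} {r C : ℝ} (hr : 0 < r) (hC : 0 ≤ C)
    (hΔ : ∀ y h, y ∈ ball x₀ (3 * r) → y + (m + 2) • h ∈ ball x₀ (3 * r) →
      |(fwdDiff h)^[m + 2] F y| ≤ C * ‖h‖ ^ (m + 1)) :
    ∃ w : ℕ → EuclideanSpace ℝ (Fin d) → ℝ, (∀ j, ContDiff ℝ ∞ (w j)) ∧
      (∀ l : List (Fin d), ∃ A, 0 ≤ A ∧ ∀ j, ∀ x ∈ ball x₀ r,
        |listDeriv l (w j) x| ≤ A * (2 ^ j) ^ l.length / (2 ^ j) ^ (m + 1)) ∧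
      ∀ x ∈ ball x₀ r, HasSum (fun j => w j x) (F x) := by
  obtain ⟨K, hK, hKF⟩ := exists_isSmoothKernel_abs_sub_le (d := d) (m + 2)
  -- The kernel has support radius `m + 2`, so every smoothing at scale at most `ε₀` reaches no
  -- further than `r`. This explains the nested balls of radii `r`, `2 * r`, `3 * r`.
  obtain ⟨ε₀, hε₀⟩ : ∃ ε₀, ε₀ = r / (m + 2) := ⟨_, rfl⟩
  have hε₀0 : 0 < ε₀ := by rw [hε₀]; positivity
  obtain ⟨ε, hε⟩ : ∃ ε : ℕ → ℝ, ∀ j, ε j = ε₀ / 2 ^ j := ⟨_, fun _ => rfl⟩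
  have hε0 : ∀ j, 0 < ε j := fun j => by rw [hε]; positivity
  have hεr : ∀ j, ε j * ((m + 2 : ℕ) : ℝ) ≤ r := by
    intro j
    have h1 : ε j ≤ ε₀ := by rw [hε]; exact div_le_self hε₀0.le (one_le_pow₀ (by norm_num))
    calc ε j * ((m + 2 : ℕ) : ℝ) ≤ ε₀ * ((m + 2 : ℕ) : ℝ) := by gcongr
      _ = r := by rw [hε₀]; push_cast; field_simp
  set T := fun j => smoothing K (ε j)
  have hT : ∀ j {G : EuclideanSpace ℝ (Fin d) → ℝ}, Continuous G → ContDiff ℝ ∞ (T j G) :=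
    fun j G hG => hK.contDiff_smoothing hG (hε0 j)
  have herr : ∀ j, ∀ x ∈ ball x₀ (2 * r), |T j F x - F x| ≤ C * ε j ^ (m + 1) := by
    intro j x hx
    refine hKF F (ε j) _ x hF fun z hz => ?_
    have hn : ‖-(ε j • z)‖ ≤ ε j := by
      rw [norm_neg, norm_smul, Real.norm_of_nonneg (hε0 j).le]
      exact mul_le_of_le_one_right (hε0 j).le hz
    have hx' := mem_ball.1 hx
    refine (hΔ x _ (by rw [mem_ball]; linarith) ?_).trans (by gcongr)
    have h1 := dist_triangle (x + (m + 2) • -(ε j • z)) x x₀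
    rw [dist_self_add_left, ← Nat.cast_smul_eq_nsmul ℝ, norm_smul,
      Real.norm_of_nonneg (by positivity)] at h1
    rw [mem_ball, ← Nat.cast_smul_eq_nsmul ℝ]
    have h2 : ((m + 2 : ℕ) : ℝ) * ‖-(ε j • z)‖ ≤ ((m + 2 : ℕ) : ℝ) * ε j := by gcongr
    linarith [hεr j]
  have hin : ∀ j, ∀ x ∈ ball x₀ r, ∀ y, dist y x ≤ ε j * ((m + 2 : ℕ) : ℝ) →
      y ∈ ball x₀ (2 * r) := by
    intro j x hx y hy
    have := mem_ball.1 hx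
    rw [mem_ball]
    linarith [dist_triangle y x x₀, hεr j]
  set u := fun j x => T (j + 1) F x - T j F x
  have hu : ∀ j, Continuous (u j) := fun j => (hT (j + 1) hF).continuous.sub (hT j hF).continuous
  have hεs : ∀ j, ε (j + 1) ≤ ε j := by
    intro j
    rw [hε, hε]
    gcongr <;> norm_num
  have hub : ∀ j, ∀ x ∈ ball x₀ (2 * r), |u j x| ≤ 2 * C * ε j ^ (m + 1) := by
    intro j x hx
    have h1 := herr j x hx
    have h2 := (herr (j + 1) x hx).trans (b := C * ε (j + 1) ^ (m + 1)) (c := C * ε j ^ (m + 1))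
      (by have := (hε0 (j + 1)).le; have := hεs j; gcongr)
    have h1' := abs_le.1 h1
    have h2' := abs_le.1 h2
    exact abs_le.2 ⟨by simp only [u]; linarith, by simp only [u]; linarith⟩
  -- The terms come from `T_{j+1}² - T_j² = (T_{j+1} + T_j)(T_{j+1} - T_j)`. The inner difference is
  -- small by `herr`; the outer smoothing converts its sup bound into bounds on all derivatives.
  let w : ℕ → EuclideanSpace ℝ (Fin d) → ℝ := fun j =>
    j.casesOn (T 0 (T 0 F)) fun j x => T (j + 1) (u j) x + T j (u j) x
  have hw : ∀ j, ContDiff ℝ ∞ (w j) := by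
    rintro (_ | j)
    · exact hT 0 (hT 0 hF).continuous
    · exact (hT (j + 1) (hu j)).add (hT j (hu j))
  have hwb : ∀ l : List (Fin d), ∃ A, 0 ≤ A ∧ ∀ j, ∀ x ∈ ball x₀ r,
      |listDeriv l (w j) x| ≤ A * (2 ^ j) ^ l.length / (2 ^ j) ^ (m + 1) := by
    intro l
    obtain ⟨A, hA⟩ : ∃ A, A = ∫ z, |listDeriv l K z| := ⟨_, rfl⟩
    have hA0 : 0 ≤ A := by rw [hA]; exact integral_nonneg fun _ => abs_nonneg _
    have hS : ∀ j {G : EuclideanSpace ℝ (Fin d) → ℝ} {B : ℝ}, Continuous G →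
        (∀ y ∈ ball x₀ (2 * r), |G y| ≤ B) → ∀ x ∈ ball x₀ r,
          |listDeriv l (T j G) x| ≤ (ε j)⁻¹ ^ l.length * (B * A) := by
      intro j G B hG hB x hx
      simp only [T]
      rw [hK.listDeriv_smoothing hG (hε0 j), abs_mul, abs_pow, abs_inv, abs_of_pos (hε0 j), hA]
      have := (hK.listDeriv l).abs_smoothing_le (F := G) (hε0 j).le (A := B) (x := x)
        fun y hy => hB y (hin j x hx y hy)
      have h0 := (hε0 j).le
      gcongr
    obtain ⟨M, hM⟩ := (isCompact_closedBall x₀ (2 * r)).exists_bound_of_continuousOn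
      (hT 0 hF).continuous.continuousOn
    have hM0 : 0 ≤ M := (norm_nonneg _).trans (hM x₀ (mem_closedBall_self (by positivity)))
    -- The outer factor counts the two smoothings in `w (j + 1)`; the inner `2 * ε₀` appears because
    -- `ε j = 2 * ε₀ / 2 ^ (j + 1)`.
    set D := 2 * (ε₀⁻¹ ^ l.length * (2 * C * (2 * ε₀) ^ (m + 1) * A))
    have hD : 0 ≤ D := by positivity
    refine ⟨max D (ε₀⁻¹ ^ l.length * (M * A)), hD.trans (le_max_left _ _), ?_⟩
    rintro (_ | j) x hx
    · have := hS 0 (hT 0 hF).continuous (fun y hy => hM y (ball_subset_closedBall hy)) x hx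
      rw [show ε 0 = ε₀ by simp [hε]] at this
      change |listDeriv l (w 0) x| ≤ _ at this
      simpa using Or.inr this
    · have e1 := hS (j + 1) (hu j) (hub j) x hx
      have e2 := hS j (hu j) (hub j) x hx
      have e3 : (ε j)⁻¹ ^ l.length * (2 * C * ε j ^ (m + 1) * A) ≤
          (ε (j + 1))⁻¹ ^ l.length * (2 * C * ε j ^ (m + 1) * A) := by
        have h1 := hε0 (j + 1)
        have h2 := hεs j
        have h3 := hε0 j
        gcongr
      have e4 : 2 * ((ε (j + 1))⁻¹ ^ l.length * (2 * C * ε j ^ (m + 1) * A)) =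
          D * (2 ^ (j + 1)) ^ l.length / (2 ^ (j + 1)) ^ (m + 1) := by
        have h1 : (ε (j + 1))⁻¹ = ε₀⁻¹ * 2 ^ (j + 1) := by rw [hε, inv_div]; ring
        have h2 : ε j = 2 * ε₀ / 2 ^ (j + 1) := by rw [hε, pow_succ]; field_simp
        rw [h1, h2, mul_pow, div_pow]
        simp only [D]
        ring
      change |listDeriv l (fun x => T (j + 1) (u j) x + T j (u j) x) x| ≤ _
      rw [listDeriv_add (hT (j + 1) (hu j)) (hT j (hu j))]
      calc _ ≤ D * (2 ^ (j + 1)) ^ l.length / (2 ^ (j + 1)) ^ (m + 1) := by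
            rw [← e4]
            refine (abs_add_le _ _).trans ?_
            linarith
        _ ≤ _ := by gcongr; exact le_max_left _ _
  refine ⟨w, hw, hwb, fun x hx => ?_⟩
  obtain ⟨A, hA0, hA⟩ := hwb []
  have hsum : Summable fun j => w j x := by
    refine .of_norm_bounded (summable_geometric_two.mul_left A) fun j => (hA j x hx).trans ?_
    have h2 : (1 : ℝ) ≤ 2 ^ j := one_le_pow₀ (by norm_num)
    have h3 : (2 : ℝ) ^ j ≤ (2 ^ j) ^ (m + 1) := le_self_pow₀ h2 (by simp)
    rw [List.length_nil, pow_zero, mul_one, one_div, inv_pow, ← div_eq_mul_inv]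
    gcongr
  refine (hsum.hasSum_iff_tendsto_nat).2 ((tendsto_add_atTop_iff_nat 1).1 ?_)
  have hpart : ∀ n, ∑ j ∈ Finset.range (n + 1), w j x = T n (T n F) x := by
    intro n
    induction n with
    | zero => simp [w]
    | succ n ih =>
      rw [Finset.sum_range_succ, ih]
      change T n (T n F) x + (T (n + 1) (u n) x + T n (u n) x) = _
      have c1 := (hT (n + 1) hF).continuous
      have c2 := (hT n hF).continuous
      have s1 := hK.smoothing_sub c1 c2 (ε (n + 1)) x
      have s2 := hK.smoothing_sub c1 c2 (ε n) x
      have s3 := hK.smoothing_comm hF (ε n) (ε (n + 1)) x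
      simp only [T, u] at *
      linarith
  simp only [hpart]
  obtain ⟨I, hI⟩ : ∃ I, I = ∫ z, |K z| := ⟨_, rfl⟩
  have hbound : ∀ n, |T n (T n F) x - F x| ≤ C * ε n ^ (m + 1) * I + C * ε n ^ (m + 1) := by
    intro n
    have h1 := hK.abs_smoothing_le (F := fun y => T n F y - F y) (hε0 n).le (x := x)
      fun y hy => herr n y (hin n x hx y hy)
    rw [hK.smoothing_sub (hT n hF).continuous hF, ← hI] at h1
    have h2 := herr n x (ball_subset_ball (by linarith) hx)
    calc _ = |(T n (T n F) x - T n F x) + (T n F x - F x)| := by congr 1; ring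
      _ ≤ _ := (abs_add_le _ _).trans (add_le_add h1 h2)
  have hεt : Tendsto ε atTop (𝓝 0) := by
    have : Tendsto (fun j : ℕ => ε₀ * (1 / 2 : ℝ) ^ j) atTop (𝓝 (ε₀ * 0)) :=
      (tendsto_pow_atTop_nhds_zero_of_lt_one (by norm_num) (by norm_num)).const_mul _
    rw [mul_zero] at this
    refine this.congr fun j => ?_
    rw [hε, one_div, inv_pow, div_eq_mul_inv]
  refine tendsto_iff_norm_sub_tendsto_zero.2 (squeeze_zero (fun _ => norm_nonneg _) hbound ?_)
  have h1 : Tendsto (fun n => C * ε n ^ (m + 1)) atTop (𝓝 0) := by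
    simpa using (hεt.pow (m + 1)).const_mul C
  simpa using (h1.mul_const I).add h1

theorem PartialZygmundOn.congr {U : Set (EuclideanSpace ℝ (Fin d))} (hU : IsOpen U) {m : ℕ}
    {f g : EuclideanSpace ℝ (Fin d) → ℝ} (hf : PartialZygmundOn m U f) (h : Set.EqOn g f U) :
    PartialZygmundOn m U g :=
  ⟨hf.1.congr h, fun l hl => (hf.2 l hl).congr hU (listDeriv_congr hU h l)⟩

theorem PartialZygmundOn.of_forall_ball {U : Set (EuclideanSpace ℝ (Fin d))} {m : ℕ}
    {f : EuclideanSpace ℝ (Fin d) → ℝ} (h : ∀ x ∈ U, ∃ r > 0, PartialZygmundOn m (ball x r) f) :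
    PartialZygmundOn m U f := by
  refine ⟨fun x hx => ?_, fun l hl => LocallyZygmundOn.of_forall_ball fun x hx => ?_⟩ <;>
    obtain ⟨r, hr, H⟩ := h x hx
  · exact (H.1.contDiffAt (ball_mem_nhds x hr)).contDiffWithinAt
  · exact ⟨r, hr, H.2 l hl⟩

/-- Smoothing needs a globally continuous function, so `f` is cut off by a bump equal to one near
`x`; differences with both end nodes in the smaller ball do not see the cutoff. -/
theorem partialZygmundOn_of_fwdDiff_bound {U : Set (EuclideanSpace ℝ (Fin d))} (hU : IsOpen U)
    {m : ℕ} {f : EuclideanSpace ℝ (Fin d) → ℝ} (hf : ContinuousOn f U)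
    (hΔ : ∀ x ∈ U, ∃ r > 0, ∃ C, 0 ≤ C ∧ ∀ y h, y ∈ ball x r → y + (m + 2) • h ∈ ball x r →
      |(fwdDiff h)^[m + 2] f y| ≤ C * ‖h‖ ^ (m + 1)) : PartialZygmundOn m U f := by
  refine PartialZygmundOn.of_forall_ball fun x hx => ?_
  obtain ⟨r₁, hr₁, C, hC, H⟩ := hΔ x hx
  obtain ⟨r₂, hr₂, hrU⟩ := nhds_basis_closedBall.mem_iff.1 (hU.mem_nhds hx)
  obtain ⟨r, hr⟩ : ∃ r, r = min r₁ r₂ / 4 := ⟨_, rfl⟩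
  have hr0 : 0 < r := by rw [hr]; positivity
  have hle₁ : 4 * r ≤ r₁ := by rw [hr]; linarith [min_le_left r₁ r₂]
  have hle₂ : 4 * r ≤ r₂ := by rw [hr]; linarith [min_le_right r₁ r₂]
  let χ : ContDiffBump x := ⟨3 * r, 4 * r, by positivity, by linarith⟩
  have hF : Continuous (fun y => χ y * f y) := by
    refine ContinuousOn.continuous_of_tsupport_subset (χ.continuous.continuousOn.mul hf) hU ?_
    refine (tsupport_mul_subset_left (f := χ) (g := f)).trans ?_
    rw [χ.tsupport_eq]
    exact (closedBall_subset_closedBall hle₂).trans hrU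
  have hFf : Set.EqOn (fun y => χ y * f y) f (ball x (3 * r)) := fun y hy => by
    simp only
    rw [χ.one_of_mem_closedBall (ball_subset_closedBall hy), one_mul]
  have hFΔ : ∀ y h, y ∈ ball x (3 * r) → y + (m + 2) • h ∈ ball x (3 * r) →
      |(fwdDiff h)^[m + 2] (fun y => χ y * f y) y| ≤ C * ‖h‖ ^ (m + 1) := by
    intro y h hy hyh
    have hs : ball x (3 * r) ⊆ ball x r₁ := ball_subset_ball (by linarith)
    have : (fwdDiff h)^[m + 2] (fun y => χ y * f y) y = (fwdDiff h)^[m + 2] f y := by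
      rw [fwdDiff_iter_eq_sum_shift, fwdDiff_iter_eq_sum_shift]
      refine Finset.sum_congr rfl fun k hk => ?_
      have hk' : k ≤ m + 2 := Nat.lt_succ_iff.1 (Finset.mem_range.1 hk)
      -- Only the end nodes are assumed to lie in the ball; convexity supplies the intermediate
      -- ones.
      have hmem := (convex_ball x (3 * r)).add_smul_mem hy hyh
        (t := (k : ℝ) / ((m + 2 : ℕ) : ℝ))
        ⟨by positivity, div_le_one_of_le₀ (by exact_mod_cast hk') (by positivity)⟩
      rw [← Nat.cast_smul_eq_nsmul ℝ, smul_smul, div_mul_cancel₀ _ (by positivity),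
        Nat.cast_smul_eq_nsmul] at hmem
      congr 1
      exact hFf hmem
    rw [this]
    exact H y h (hs hy) (hs hyh)
  obtain ⟨w, hw, hwb, hws⟩ := exists_dyadic_series hF hr0 hC hFΔ
  refine ⟨r, hr0, ?_⟩
  exact (partialZygmundOn_of_dyadic_series isOpen_ball (convex_ball x r) hw hwb hws).congr
    isOpen_ball fun y hy => (hFf (ball_subset_ball (by linarith) hy)).symm

end Main

end

theorem theorem1p1 (d m : ℕ) (U : Set (EuclideanSpace ℝ (Fin d))) (hU : IsOpen U)
    (f : EuclideanSpace ℝ (Fin d) → ℝ) :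
    (∀ c : ℝ → EuclideanSpace ℝ (Fin d), ContDiff ℝ ∞ c → (∀ t, c t ∈ U) →
      IsZygmundReal m (f ∘ c)) ↔ IsZygmund m U f := by
  rw [isZygmund_iff hU]
  refine ⟨fun h => ?_, fun h c hc hcU => h.comp_curve hU hc hcU⟩
  exact partialZygmundOn_of_fwdDiff_bound hU
    (continuousOn_of_comp_curve hU fun c hc hcU => (h c hc hcU).1.continuous)
    fun x hx => exists_ball_fwdDiff_bound hU h hx
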